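/- **Setting.** Let $d\in\{1,2,3\}$, $p\ge 1$. Let $\mathcal T_h=\{K_e\}$ be a finite mesh of convex polytopes $K_e\subset\mathbb R^d$ with non-empty, pairwise disjoint interiors, $\Omega$ the interior of $\bigcup_e K_e$ and $h_e=\operatorname{diam}K_e$. Let $\mathcal F$ be its finite set of faces: closed sets $F$ of positive $(d-1)$-dimensional measure, overlapping in null sets only, each lying in a supporting hyperplane of every element to which it is adjacent, such that the boundary of each element is covered by the faces adjacent to it. A face either separates two elements $K^+,K^-$ or lies on $\partial\Omega$ and is adjacent to one element $K^+$; its unit normal $\mathbf n_{K^+}=-\mathbf n_{K^-}$ is constant and points out of $K^+$ (hanging nodes are allowed). Put $h_F=\operatorname{diam}F$ if $d\ge2$; if $d=1$, $h_F$ is the smallest diameter of an element adjacent to $F$. For each $e$ let $V_h(K_e)$ be $\mathbb P_p(K_e)$ or $\mathbb Q_p(K_e)$ (polynomials of total degree at most $p$, or of degree at most $p$ in each variable with respect to a fixed affine coordinate system on $K_e$), and $V_h=\{v_h\in L^2(\Omega): v_h|_{K_e}\in V_h(K_e)\ \forall e\}$. Let $\varepsilon>0$, $\mathbf b\in W^{1,\infty}(\Omega)^d$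 (with a representative continuous on $\bar\Omega$), $0\le c\in L^\infty(\Omega)$ and $c-\tfrac12\nabla\cdot\mathbf b\ge\sigma_0>0$ a.e. in $\Omega$. On a face between $K^+$ and $K^-$ write $[\![v]\!]=v|_{K^+}\mathbf n_{K^+}+v|_{K^-}\mathbf n_{K^-}$ and $\{\!\{\nabla v\}\!\}=\tfrac12(\nabla v|_{K^+}+\nabla v|_{K^-})$; $v^\uparrow$ is $v|_{K^+}$ where $\mathbf b\cdot\mathbf n_{K^+}\ge0$ and $v|_{K^-}$ elsewhere. On a boundary face, $\nabla v|_{K^-}$ is replaced by $\nabla v|_{K^+}$ in the average, and $v|_{K^-}$ by $0$ in the jump and in $v^\uparrow$. For $\eta>0$ set $$a(v,w)=\varepsilon\Big[\sum_e(\nabla w,\nabla v)_{K_e}-\sum_{F\in\mathcal F}\int_F\{\!\{\nabla w\}\!\}\cdot[\![v]\!]+\{\!\{\nabla v\}\!\}\cdot[\![w]\!]-\tfrac{\eta}{h_F}[\![w]\!]\cdot[\![v]\!]\,d\sigma\Big]-\sum_e(v,\mathbf b\cdot\nabla w)_{K_e}+\sum_{F\in\mathcal F}\int_F v^\uparrow\,\mathbf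 b\cdot[\![w]\!]\,d\sigma+((c-\nabla\cdot\mathbf b)v,w)_\Omega .$$ Let $P_h$ be the $L^2$-orthogonal projection onto $V_h$, applied componentwise, $\kappa_e(\nabla v)=(\nabla v-P_h\nabla v)|_{K_e}$ with $\nabla$ the elementwise gradient, $\nu_e=\|\mathbf b\|_{L^\infty(K_e)}h_e/(2p)$, and let $\gamma=(\gamma_e)_e$ be any map assigning to each $v_h\in V_h$ blending factors $\gamma_e(v_h)\in[0,1]$ (for instance a WENO smoothness sensor). Set $$d_h(u;v,w)=\sum_e\gamma_e(u)\,\nu_e\,(\kappa_e(\nabla w),\kappa_e(\nabla v))_{K_e}+(1-\gamma_e(u))\,\nu_e\,(\nabla w,\nabla v)_{K_e}.$$ For a linear form $\ell_h$ on $V_h$, the nonlinear DG-WENO scheme reads: find $u_h\in V_h$ with $$a(u_h,v_h)+d_h(u_h;u_h,v_h)=\ell_h(v_h)\qquad\forall v_h\in V_h.\tag{$*$}$$ Call $C\ge0$ a discrete trace constant of the mesh if $h_F^{1/2}\|v\|_{L^2(F)}\le C\|v\|_{L^2(K_e)}$ for all $e$, all faces $F$ adjacent to $K_e$ and all $v\in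 V_h(K_e)$, and let $N_\partial$ be the largest number of faces adjacent to an element. **Lemma.** (i) A discrete trace constant exists. (ii) Let $C$ be a discrete trace constant and let the penalty parameter satisfy $\eta>C^2N_\partial$. Then, for all data $\varepsilon,\mathbf b,c,\sigma_0$ as above and every $\gamma$ as above such that $v_h\mapsto\gamma(v_h)$ is continuous on the finite-dimensional space $V_h$, the scheme $(*)$ has at least one solution $u_h\in V_h$ for every linear form $\ell_h$ on $V_h$. In particular, it has a solution for all $g\in L^2(\Omega)$ and $u_D\in L^2(\partial\Omega)$ with the consistent right-hand side $$\ell_h(w)=(g,w)_\Omega+\sum_{F\subset\partial\Omega}\int_F\Big(\varepsilon\big(\tfrac{\eta}{h_F}w-\nabla w\cdot\mathbf n\big)-\min\{\mathbf b\cdot\mathbf n,0\}\,w\Big)u_D\,d\sigma .$$ -/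

import Mathlib

open MeasureTheory
open scoped MeasureTheory Gradient ContDiff

namespace DGWENO

/-- Euclidean space of dimension `d`. -/
abbrev Pt (d : ℕ) := EuclideanSpace ℝ (Fin d)

/-- The two local polynomial families: `P` (total degree at most `p`) and
`Q` (degree at most `p` in each variable). -/
inductive PolyKind where
  | P
  | Q

/-- The part of the convex set `K` that lies on its supporting hyperplane with outward normal `n`. -/
def supportFace {d : ℕ} (K : Set (Pt d)) (n : Pt d) : Set (Pt d) :=
  {x ∈ K | ∀ y ∈ K, inner ℝ n y ≤ inner ℝ n x}

/-- A mesh of convex polytopal elements `cell i` (indexed by `ι`) together with its set of faces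
`face k` (indexed by `κ`). A face either lies between the two elements `plus k` and `j`
(`minus k = some j`), or lies on the boundary of the meshed domain and is adjacent to the element
`plus k` only (`minus k = none`). The vector `normal k` is the unit normal on `face k` pointing out
of the element `plus k`. Hanging nodes are allowed. -/
structure Mesh (d : ℕ) (ι κ : Type*) where
  cell : ι → Set (Pt d)
  cell_polytope : ∀ i, ∃ s : Finset (Pt d), cell i = convexHull ℝ (s : Set (Pt d))
  cell_interior : ∀ i, (interior (cell i)).Nonempty
  cell_disjoint : ∀ i j, i ≠ j → Disjoint (interior (cell i)) (interior (cell j))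
  /-- the local polynomial family used on each element -/
  kind : ι → PolyKind
  /-- the affine map from reference to physical coordinates on each element
  (it only matters for the family `Q`; the identity gives polynomials in the physical coordinates) -/
  frame : ι → (Pt d ≃ᵃ[ℝ] Pt d)
  face : κ → Set (Pt d)
  plus : κ → ι
  minus : κ → Option ι
  normal : κ → Pt d
  norm_normal : ∀ k, ‖normal k‖ = 1
  face_closed : ∀ k, IsClosed (face k)
  face_pos : ∀ k, 0 < (μHE[d - 1] : Measure (Pt d)) (face k)
  face_plus : ∀ k, face k ⊆ supportFace (cell (plus k)) (normal k)
  face_minus : ∀ k j, minus k = some j → face k ⊆ supportFace (cell j) (-normal k)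
  face_boundary : ∀ k, minus k = none → face k ⊆ frontier (⋃ i, cell i)
  face_cover : ∀ i, ∀ x ∈ frontier (cell i), ∃ k, (plus k = i ∨ minus k = some i) ∧ x ∈ face k
  face_disjoint : ∀ k l, k ≠ l → (μHE[d - 1] : Measure (Pt d)) (face k ∩ face l) = 0

/-- The linear map sending a polynomial `q` in the reference coordinates to the
function `q ∘ T⁻¹` of the physical coordinates. -/
noncomputable def evalFrame {d : ℕ} (T : Pt d ≃ᵃ[ℝ] Pt d) :
    MvPolynomial (Fin d) ℝ →ₗ[ℝ] (Pt d → ℝ) where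
  toFun q := fun x => MvPolynomial.eval (fun j => T.symm x j) q
  map_add' q r := by ext x; simp
  map_smul' a q := by ext x; simp

/-- The polynomial space of the given kind and degree, in the reference coordinates. -/
noncomputable def refSpace (d p : ℕ) : PolyKind → Submodule ℝ (MvPolynomial (Fin d) ℝ)
  | .P => MvPolynomial.restrictTotalDegree (Fin d) ℝ p
  | .Q => MvPolynomial.restrictDegree (Fin d) ℝ p

/-- The local space of polynomial functions. -/
noncomputable def localSpace {d : ℕ} (p : ℕ) (kind : PolyKind) (T : Pt d ≃ᵃ[ℝ] Pt d) :
    Submodule ℝ (Pt d → ℝ) :=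
  (refSpace d p kind).map (evalFrame T)

/-- `f ∈ W^{1,∞}(Ω)` with weak partial derivatives `Df j ∈ L^∞(Ω)`. -/
structure IsW1Inf {d : ℕ} (Ω : Set (Pt d)) (f : Pt d → ℝ) (Df : Fin d → Pt d → ℝ) : Prop where
  memLp : MemLp f ⊤ (volume.restrict Ω)
  memLp_deriv : ∀ j, MemLp (Df j) ⊤ (volume.restrict Ω)
  weak_deriv : ∀ (j : Fin d) (φ : Pt d → ℝ), ContDiff ℝ ∞ φ → HasCompactSupport φ →
    tsupport φ ⊆ Ω →
      ∫ x in Ω, f x * fderiv ℝ φ x (EuclideanSpace.single j 1) = -∫ x in Ω, Df j x * φ x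

/-- Coefficients of the convection-diffusion-reaction equation
`-ε Δu + b · ∇u + c u = g` on `Ω`. The field `b` is the continuous representative of an element
of `W^{1,∞}(Ω)^d`, and `Db i j` is the weak `j`-th partial derivative of its `i`-th component. -/
structure Coefficients {d : ℕ} (Ω : Set (Pt d)) where
  ε : ℝ
  ε_pos : 0 < ε
  b : Pt d → Pt d
  b_cont : ContinuousOn b (closure Ω)
  Db : Fin d → Fin d → Pt d → ℝ
  b_W1Inf : ∀ i, IsW1Inf Ω (fun x => b x i) (Db i)
  c : Pt d → ℝ
  c_memLp : MemLp c ⊤ (volume.restrict Ω)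
  c_nonneg : ∀ᵐ x ∂(volume.restrict Ω), 0 ≤ c x
  σ₀ : ℝ
  σ₀_pos : 0 < σ₀
  σ_ge : ∀ᵐ x ∂(volume.restrict Ω), σ₀ ≤ c x - 1 / 2 * ∑ i, Db i i x

/-- The divergence of the velocity field. -/
def Coefficients.divb {d : ℕ} {Ω : Set (Pt d)} (D : Coefficients Ω) (x : Pt d) : ℝ :=
  ∑ i, D.Db i i x

namespace Mesh

variable {d : ℕ} {ι κ : Type*}

/-- The meshed domain `Ω`: the open set whose closure is the union of the elements. -/
def domain (M : Mesh d ι κ) : Set (Pt d) := interior (⋃ i, M.cell i)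

/-- The face `k` belongs to the boundary of the element `i`. -/
def Adj (M : Mesh d ι κ) (k : κ) (i : ι) : Prop := M.plus k = i ∨ M.minus k = some i

/-- The element diameter `h_e`. -/
noncomputable def cellSize (M : Mesh d ι κ) (i : ι) : ℝ := Metric.diam (M.cell i)

/-- The face length scale `h_F`: the diameter of the face if `d ≥ 2`; in one space dimension, where
faces are points, the smallest diameter of an adjacent element. -/
noncomputable def faceSize (M : Mesh d ι κ) (k : κ) : ℝ :=
  if d = 1 then
    match M.minus k with
    | some j => min (M.cellSize (M.plus k)) (M.cellSize j)
    | none => M.cellSize (M.plus k)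
  else Metric.diam (M.face k)

/-- The largest number of faces of an element. -/
noncomputable def maxFaces [Fintype ι] (M : Mesh d ι κ) : ℕ :=
  Finset.univ.sup fun i => Nat.card {k : κ // M.Adj k i}

/-- The discontinuous finite element space: one polynomial function of degree `p` for each element.
Its topology (pointwise convergence) is the only Hausdorff vector space topology of this
finite-dimensional space, the one given by every norm on it. -/
abbrev DGSpace (M : Mesh d ι κ) (p : ℕ) : Type _ :=
  (i : ι) → localSpace p (M.kind i) (M.frame i)

/-- The value of the broken polynomial `v` on the element `i`. -/
def val {M : Mesh d ι κ} {p : ℕ} (v : M.DGSpace p) (i : ι) : Pt d → ℝ := (v i : Pt d → ℝ)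

/-- The gradient of the broken polynomial `v` on the element `i`. -/
noncomputable def grad {M : Mesh d ι κ} {p : ℕ} (v : M.DGSpace p) (i : ι) (x : Pt d) : Pt d :=
  ∇ (val v i) x

/-- `C` is a constant of the discrete trace inequality
`h_F^{1/2} ‖v‖_{0,F} ≤ C ‖v‖_{0,K_e}` for all local functions `v` and all faces `F` of `K_e`. -/
def IsTraceConstant (M : Mesh d ι κ) (p : ℕ) (C : ℝ) : Prop :=
  0 ≤ C ∧ ∀ (k : κ) (i : ι), M.Adj k i → ∀ v ∈ localSpace p (M.kind i) (M.frame i),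
    Real.sqrt (M.faceSize k) * Real.sqrt (∫ x in M.face k, v x ^ 2 ∂μHE[d - 1])
      ≤ C * Real.sqrt (∫ x in M.cell i, v x ^ 2)

/-- The trace of `v` from the `minus` side of a face (zero on boundary faces). -/
def minusVal {M : Mesh d ι κ} {p : ℕ} (v : M.DGSpace p) (k : κ) (x : Pt d) : ℝ :=
  match M.minus k with
  | some j => val v j x
  | none => 0

/-- The average of the gradient on a face (the one-sided trace on boundary faces). -/
noncomputable def avgGrad {M : Mesh d ι κ} {p : ℕ} (v : M.DGSpace p) (k : κ) (x : Pt d) : Pt d :=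
  match M.minus k with
  | some j => (1 / 2 : ℝ) • (grad v (M.plus k) x + grad v j x)
  | none => grad v (M.plus k) x

/-- The scalar jump `v⁺ - v⁻` across a face. -/
def sjump {M : Mesh d ι κ} {p : ℕ} (v : M.DGSpace p) (k : κ) (x : Pt d) : ℝ :=
  val v (M.plus k) x - minusVal v k x

/-- The vector-valued jump `v⁺ n⁺ + v⁻ n⁻`. -/
noncomputable def jump {M : Mesh d ι κ} {p : ℕ} (v : M.DGSpace p) (k : κ) (x : Pt d) : Pt d :=
  sjump v k x • M.normal k

/-- The upwind flux `b · n⁺ v^↑` through a face, oriented by the normal `n⁺`: the trace is taken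
from the side that the flow comes from; on inflow boundary faces it is zero. -/
noncomputable def upwindFlux {M : Mesh d ι κ} {p : ℕ} (b : Pt d → Pt d) (v : M.DGSpace p)
    (k : κ) (x : Pt d) : ℝ :=
  if 0 ≤ inner ℝ (b x) (M.normal k) then inner ℝ (b x) (M.normal k) * val v (M.plus k) x
  else inner ℝ (b x) (M.normal k) * minusVal v k x

variable [Fintype ι] [Fintype κ]

/-- The DG bilinear form `a(v, w)`: symmetric interior penalty with parameter `η` for the diffusive
part, upwind fluxes for the convective part. -/
noncomputable def bilin (M : Mesh d ι κ) {p : ℕ} (D : Coefficients M.domain) (η : ℝ)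
    (v w : M.DGSpace p) : ℝ :=
  D.ε * ((∑ i, ∫ x in M.cell i, inner ℝ (grad w i x) (grad v i x))
      - ∑ k, ∫ x in M.face k,
          (inner ℝ (avgGrad w k x) (jump v k x) + inner ℝ (avgGrad v k x) (jump w k x)
            - η / M.faceSize k * inner ℝ (jump w k x) (jump v k x)) ∂μHE[d - 1])
    - (∑ i, ∫ x in M.cell i, val v i x * inner ℝ (D.b x) (grad w i x))
    + (∑ k, ∫ x in M.face k, upwindFlux D.b v k x * sjump w k x ∂μHE[d - 1])
    + ∑ i, ∫ x in M.cell i, (D.c x - D.divb x) * val v i x * val w i x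

/-- The artificial viscosity `ν_e = λ_e h_e / (2p)` with `λ_e = ‖b‖_{L^∞(K_e)}`. -/
noncomputable def viscosity (M : Mesh d ι κ) (p : ℕ) (D : Coefficients M.domain) (i : ι) : ℝ :=
  (eLpNorm D.b ⊤ (volume.restrict (M.cell i))).toReal * M.cellSize i / (2 * p)

/-- `q` is the `L²` orthogonal projection onto the DG space of the broken function `g`. -/
def IsL2Projection (M : Mesh d ι κ) {p : ℕ} (g : ι → Pt d → ℝ) (q : M.DGSpace p) : Prop :=
  ∀ w : M.DGSpace p, ∑ i, ∫ x in M.cell i, (g i x - val q i x) * val w i x = 0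

/-- The `L²` orthogonal projection `P_h` onto the DG space. -/
noncomputable def l2Proj (M : Mesh d ι κ) (p : ℕ) (g : ι → Pt d → ℝ) : M.DGSpace p :=
  Classical.epsilon (M.IsL2Projection g)

/-- The fluctuation `κ_e(∇v) = ∇v - P_h ∇v` on the element `i`, with `P_h` acting
componentwise. -/
noncomputable def fluctuation (M : Mesh d ι κ) {p : ℕ} (v : M.DGSpace p) (i : ι) (x : Pt d) :
    Pt d :=
  grad v i x - WithLp.toLp 2 fun j => val (M.l2Proj p fun i x => grad v i x j) i x

/-- The nonlinear stabilization `d_h(u; v, w)`, a blend of high-order and low-order terms with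
blending factors `γ_e(u)`. -/
noncomputable def stab (M : Mesh d ι κ) {p : ℕ} (D : Coefficients M.domain)
    (γ : M.DGSpace p → ι → ℝ) (u v w : M.DGSpace p) : ℝ :=
  ∑ i, (γ u i * (M.viscosity p D i *
        ∫ x in M.cell i, inner ℝ (M.fluctuation w i x) (M.fluctuation v i x))
    + (1 - γ u i) * (M.viscosity p D i *
        ∫ x in M.cell i, inner ℝ (grad w i x) (grad v i x)))

/-- `u` solves the nonlinear DG scheme with right-hand side `ℓ`. -/
def IsSolution (M : Mesh d ι κ) {p : ℕ} (D : Coefficients M.domain) (η : ℝ)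
    (γ : M.DGSpace p → ι → ℝ) (ℓ : M.DGSpace p → ℝ) (u : M.DGSpace p) : Prop :=
  ∀ w : M.DGSpace p, M.bilin D η u w + M.stab D γ u u w = ℓ w

/-- The consistent right-hand side for the source term `g` and the boundary datum `uD`. -/
noncomputable def rhs (M : Mesh d ι κ) {p : ℕ} (D : Coefficients M.domain) (η : ℝ)
    (g uD : Pt d → ℝ) (w : M.DGSpace p) : ℝ :=
  (∑ i, ∫ x in M.cell i, g x * val w i x)
    + ∑ k, if M.minus k = none then
        ∫ x in M.face k,
          (D.ε * (η / M.faceSize k * val w (M.plus k) x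
              - inner ℝ (grad w (M.plus k) x) (M.normal k))
            - min (inner ℝ (D.b x) (M.normal k)) 0 * val w (M.plus k) x) * uD x ∂μHE[d - 1]
      else 0

end Mesh

end DGWENO

/-!
The scheme is a nonlinear equation `F (u; w) = ℓ w` on a finite-dimensional space, linear in `w`
and continuous in `u`, and it is solvable because `F (v; v) ≥ σ₀ ‖v‖²`.

**Solvability from coercivity** (`exists_solution_of_coercive`). In coordinates, the residual of
the equation is a continuous vector field that points outward on a large sphere, so it has a zero
(`exists_zero_of_continuous_outward`). This consequence of Brouwer's theorem is reduced, through a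
smooth approximation, to the absence of a continuously differentiable retraction of a ball onto
its boundary (`not_exists_contDiff_retraction`), which is shown by the volume argument of Milnor
and Rogers.

**Diffusion** (`diffusion_nonneg`). The components of the gradient of a broken polynomial are
again polynomials of the local spaces, so the discrete trace inequality bounds the average
gradients on the faces by the element gradients, each element being counted at most `N_∂` times.
Young's inequality absorbs the consistency terms into the volume term and the penalty when `η > C²
N_∂`. A trace constant exists because both sides of the trace inequality are quadratic forms on
finite-dimensional spaces, and the `L²` norm over an element is definite on polynomials
(`exists_isTraceConstant`).

**Convection and reaction** (`convection_ge`). Integrating `b · ∇ v² / 2` by parts on each element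
turns the volume terms into `(c - ½ ∇ · b) v² ≥ σ₀ v²`, and upwinding makes the face terms add up
to the nonnegative `½ |b · n| (v⁺ - v⁻)²`. The field `b` has only weak derivatives inside `Ω`, so
the divergence theorem is proved directly (`integral_divergence_polytope`): a polytope is an
intersection of half-spaces, a product of ramps of the distances to their hyperplanes is a test
function, and as the ramps steepen the boundary layers concentrate on the facets
(`tendsto_boundary_layer`). On a mesh with hanging nodes, the facets of an element are unions of
faces (`setIntegral_facet`).

**Stabilization** (`stab_nonneg`, `continuous_stab`). The blending factors lie in `[0, 1]` and
depend continuously on `u`. The gradient of a broken polynomial has components in the DG space, so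
its fluctuation vanishes (`fluctuation_eq_zero`) and only the low-order part of the stabilization
remains, which is a nonnegative multiple of the element stiffness forms.
-/

namespace DGWENO

/-! ### Zeros of outward pointing vector fields -/

section Zeros

open Metric Polynomial

variable {E : Type*} [NormedAddCommGroup E] [InnerProductSpace ℝ E] [FiniteDimensional ℝ E]

/-- The value at `1` of a polynomial of degree at most `n` is a combination of its values at `n + 1`
nodes in `(0, t)`, with nodes and weights that do not depend on the polynomial. -/
theorem exists_lagrange_weights (n : ℕ) (t : ℝ) (ht : 0 < t) :
    ∃ (τ c : ℕ → ℝ), (∀ i ∈ Finset.range (n + 1), τ i ∈ Set.Ioo 0 t) ∧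
      ∀ q : ℝ[X], q.natDegree ≤ n →
        q.eval 1 = ∑ i ∈ Finset.range (n + 1), c i * q.eval (τ i) := by
  have hinj : Set.InjOn (fun i : ℕ => t / (i + 2)) (Finset.range (n + 1)) := by
    intro i _ j _ hij
    have hi : (0 : ℝ) < i + 2 := by positivity
    have hj : (0 : ℝ) < j + 2 := by positivity
    simp only at hij
    rw [div_eq_div_iff hi.ne' hj.ne'] at hij
    have := mul_left_cancel₀ ht.ne' hij
    exact_mod_cast (by linarith : (i : ℝ) = j)
  refine ⟨fun i => t / (i + 2),
    fun i => (Lagrange.basis (Finset.range (n + 1)) (fun i : ℕ => t / (i + 2)) i).eval 1, ?_, ?_⟩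
  · intro i _
    have hi : (1 : ℝ) < i + 2 := by
      have : (0 : ℝ) ≤ i := by positivity
      linarith
    exact ⟨by positivity, div_lt_self ht hi⟩
  · intro q hq
    have hdeg : q.degree < (Finset.range (n + 1)).card := by
      rw [Finset.card_range]
      exact lt_of_le_of_lt (degree_le_of_natDegree_le hq) (by exact_mod_cast Nat.lt_succ_self n)
    conv_lhs => rw [Lagrange.eq_interpolate hinj hdeg]
    rw [Lagrange.interpolate_apply, eval_finsetSum]
    refine Finset.sum_congr rfl fun i _ => ?_
    rw [eval_mul, eval_C, mul_comm]

/-- `det (1 + t A)` is a polynomial in `t` of degree at most the dimension of the space. -/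
theorem exists_polynomial_det_one_add_smul (A : E →L[ℝ] E) :
    ∃ q : ℝ[X], q.natDegree ≤ Module.finrank ℝ E ∧
      ∀ t : ℝ, (ContinuousLinearMap.id ℝ E + t • A).det = q.eval t := by
  let b := Module.finBasis ℝ E
  let a := LinearMap.toMatrix b b (A : E →ₗ[ℝ] E)
  refine ⟨Matrix.det ((X : ℝ[X]) • a.map C + (1 : Matrix _ _ ℝ).map C), ?_, fun t => ?_⟩
  · simpa using Polynomial.natDegree_det_X_add_C_le a 1
  · rw [ContinuousLinearMap.det, ← LinearMap.det_toMatrix b]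
    rw [← Polynomial.coe_evalRingHom, RingHom.map_det]
    congr 1
    ext i j
    simp [a, Matrix.one_apply, LinearMap.toMatrix_apply, Finsupp.single_apply, add_comm,
      eq_comm]
    split_ifs <;> simp [mul_comm]

/-- A Lipschitz perturbation of the identity of the open unit ball that vanishes on the unit
sphere maps the ball onto itself, provided its Lipschitz constant is less than one. -/
theorem image_ball_id_add {g : E → E} {K : NNReal} (hK : K < 1)
    (hg : LipschitzOnWith K g (closedBall 0 1)) (hs : ∀ x, ‖x‖ = 1 → g x = 0)
    (hmaps : ∀ x ∈ ball (0 : E) 1, x + g x ∈ ball (0 : E) 1) :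
    (fun x => x + g x) '' ball 0 1 = ball 0 1 := by
  classical
  refine Set.Subset.antisymm (Set.image_subset_iff.2 hmaps) fun y hy => ?_
  -- the extension of `g` by zero is Lipschitz since every segment leaving the ball meets the sphere
  let G : E → E := fun x => if ‖x‖ ≤ 1 then g x else 0
  have key : ∀ x z : E, ‖x‖ ≤ 1 → 1 < ‖z‖ → ‖g x‖ ≤ K * ‖x - z‖ := by
    intro x z hx hz
    have hc : ContinuousOn (fun s : ℝ => ‖x + s • (z - x)‖) (Set.Icc 0 1) := by fun_prop
    obtain ⟨s, hs1, hs2⟩ := intermediate_value_Icc zero_le_one hc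
      (show (1 : ℝ) ∈ Set.Icc _ _ by simp [hx, hz.le])
    have h1 := hg.norm_sub_le (x := x) (y := x + s • (z - x)) (by simpa using hx)
      (by simpa using hs2.le)
    rw [hs _ hs2, sub_zero] at h1
    refine h1.trans (mul_le_mul_of_nonneg_left ?_ K.2)
    rw [sub_add_cancel_left, norm_neg, norm_smul, Real.norm_of_nonneg hs1.1, norm_sub_rev x z]
    exact mul_le_of_le_one_left (norm_nonneg _) hs1.2
  have hG : LipschitzWith K G := by
    refine LipschitzWith.of_dist_le_mul fun x z => ?_
    simp only [G, dist_eq_norm]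
    split_ifs with h1 h2 h2
    · exact hg.norm_sub_le (by simpa using h1) (by simpa using h2)
    · simpa using key x z h1 (not_le.1 h2)
    · simpa [norm_sub_rev x z] using key z x h2 (not_le.1 h1)
    · simp only [sub_self, norm_zero]; positivity
  have hF : ContractingWith K (fun x => y - G x) := by
    refine ⟨hK, LipschitzWith.of_dist_le_mul fun x z => ?_⟩
    rw [dist_sub_left]
    exact hG.dist_le_mul x z
  obtain ⟨x, hx⟩ : ∃ x, y - G x = x := ⟨_, hF.fixedPoint_isFixedPt⟩
  by_cases h : ‖x‖ < 1
  · refine ⟨x, by simpa using h, ?_⟩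
    have : G x = g x := if_pos h.le
    simp only
    rw [← this, ← eq_sub_iff_add_eq]
    exact hx.symm
  · have hGx : G x = 0 := by
      simp only [G]
      split_ifs with h'
      · exact hs x (le_antisymm h' (not_lt.1 h))
      · rfl
    rw [hGx, sub_zero] at hx
    rw [hx] at hy
    exact absurd (by simpa using hy) h

/-- There is no continuously differentiable retraction of the unit ball onto the unit sphere. With
`g x = f x - x`, the integral over the ball of the Jacobian of `x ↦ x + t g x` is a polynomial in
`t`. For small `t` the map is a bijection of the ball, so the integral is the volume of the ball,
and then this holds for all `t`; but at `t = 1` the map is `f`, whose Jacobian vanishes because its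
values have norm one. -/
theorem not_exists_contDiff_retraction {f : E → E} {U : Set E} (hU : IsOpen U)
    (hUB : closedBall 0 1 ⊆ U) (hf : ContDiffOn ℝ 1 f U)
    (hf1 : ∀ x ∈ closedBall (0 : E) 1, ‖f x‖ = 1) (hfs : ∀ x, ‖x‖ = 1 → f x = x) : False := by
  let _ : MeasurableSpace E := borel E
  have _ : BorelSpace E := ⟨rfl⟩
  let μ : Measure E := Measure.addHaar
  let B : Set E := ball 0 1
  have hBc : B ⊆ closedBall 0 1 := ball_subset_closedBall
  let g : E → E := fun x => f x - x
  have hd : ∀ x ∈ closedBall (0 : E) 1,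
      HasFDerivAt g (fderiv ℝ f x - ContinuousLinearMap.id ℝ E) x :=
    fun x hx => (((hf.differentiableOn one_ne_zero).differentiableAt
      (hU.mem_nhds (hUB hx))).hasFDerivAt).sub (hasFDerivAt_id x)
  let A : E → E →L[ℝ] E := fun x => fderiv ℝ f x - ContinuousLinearMap.id ℝ E
  have hAc : ContinuousOn A (closedBall 0 1) :=
    ((hf.continuousOn_fderiv_of_isOpen hU le_rfl).mono hUB).sub continuousOn_const
  obtain ⟨K, hK⟩ : ∃ K : ℝ, ∀ x ∈ closedBall (0 : E) 1, ‖A x‖ ≤ K :=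
    (isCompact_closedBall 0 1).exists_bound_of_continuousOn hAc
  let L : NNReal := ⟨max K 1, le_max_of_le_right zero_le_one⟩
  have hL0 : (0 : ℝ) < L := lt_max_of_lt_right one_pos
  have hLA : ∀ x ∈ closedBall (0 : E) 1, ‖A x‖ ≤ L := fun x hx => (hK x hx).trans (le_max_left _ _)
  have hLip : LipschitzOnWith L g (closedBall 0 1) :=
    (convex_closedBall 0 1).lipschitzOnWith_of_nnnorm_hasFDerivWithin_le
      (fun x hx => (hd x hx).hasFDerivWithinAt) hLA
  have hdetc : ∀ t : ℝ, ContinuousOn (fun x => (ContinuousLinearMap.id ℝ E + t • A x).det)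
      (closedBall 0 1) := fun t =>
    ContinuousLinearMap.continuous_det.comp_continuousOn
      (continuousOn_const.add (hAc.const_smul t))
  have hint : ∀ t : ℝ, IntegrableOn (fun x => (ContinuousLinearMap.id ℝ E + t • A x).det) B μ :=
    fun t => ((hdetc t).integrableOn_compact (isCompact_closedBall 0 1)).mono_set hBc
  -- for small `t` the map `x ↦ x + t g x` is a bijection of the ball with positive Jacobian
  have hinv : ∀ x ∈ B, ∀ t ∈ Set.Ioo (0 : ℝ) (1 / L),
      (ContinuousLinearMap.id ℝ E + t • A x).det ≠ 0 := by
    intro x hx t ht h0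
    obtain ⟨v, hv0, hv⟩ : ∃ v, v ≠ 0 ∧ (ContinuousLinearMap.id ℝ E + t • A x) v = 0 := by
      have := LinearMap.bot_lt_ker_of_det_eq_zero h0
      obtain ⟨v, hv, hv0⟩ := (Submodule.ne_bot_iff _).1 this.ne'
      exact ⟨v, hv0, hv⟩
    have h1 : ‖v‖ ≤ t * L * ‖v‖ := by
      have h2 : v = -(t • A x v) := by
        rw [← add_eq_zero_iff_eq_neg]; simpa using hv
      calc ‖v‖ = ‖-(t • A x v)‖ := by rw [← h2]
        _ = t * ‖A x v‖ := by rw [norm_neg, norm_smul, Real.norm_of_nonneg ht.1.le]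
        _ ≤ t * (L * ‖v‖) := mul_le_mul_of_nonneg_left
            ((A x).le_of_opNorm_le (hLA x (hBc hx)) v) ht.1.le
        _ = t * L * ‖v‖ := by ring
    have h3 : t * L < 1 := by
      have := ht.2; rwa [lt_div_iff₀ hL0] at this
    have h4 : 0 < ‖v‖ := norm_pos_iff.2 hv0
    nlinarith
  have hpos : ∀ x ∈ B, ∀ t ∈ Set.Ioo (0 : ℝ) (1 / L),
      0 < (ContinuousLinearMap.id ℝ E + t • A x).det := by
    intro x hx t ht
    by_contra hneg
    have hc : ContinuousOn (fun s : ℝ => (ContinuousLinearMap.id ℝ E + s • A x).det)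
        (Set.Icc 0 t) :=
      (ContinuousLinearMap.continuous_det.comp (by fun_prop)).continuousOn
    have h1 : (ContinuousLinearMap.id ℝ E + (0 : ℝ) • A x).det = 1 := by
      simp [ContinuousLinearMap.det]
    obtain ⟨s, hs, hs0⟩ := intermediate_value_Icc' ht.1.le hc
      (show (0 : ℝ) ∈ Set.Icc _ _ from ⟨not_lt.1 hneg, by simp only [h1]; exact zero_le_one⟩)
    rcases hs.1.eq_or_lt with h | h
    · subst h; simp only [h1] at hs0; exact one_ne_zero hs0
    · exact hinv x hx s ⟨h, hs.2.trans_lt ht.2⟩ hs0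
  have hvol : ∀ t ∈ Set.Ioo (0 : ℝ) (1 / L),
      ∫ x in B, (ContinuousLinearMap.id ℝ E + t • A x).det ∂μ = μ.real B := by
    intro t ht
    have htL : t * L < 1 := by
      have := ht.2; rwa [lt_div_iff₀ hL0] at this
    have ht1 : t < 1 := by
      have h1L : (1 : ℝ) ≤ L := le_max_right _ _
      nlinarith [ht.1]
    let T : NNReal := t.toNNReal
    have hT : (T : ℝ) = t := Real.coe_toNNReal t ht.1.le
    have hTL : ((T * L : NNReal) : ℝ) = t * L := by rw [NNReal.coe_mul, hT]
    have hlipt : LipschitzOnWith (T * L) (fun x => t • g x) (closedBall 0 1) := by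
      refine LipschitzOnWith.of_dist_le_mul fun x hx y hy => ?_
      rw [dist_smul₀, Real.norm_of_nonneg ht.1.le]
      have := hLip.dist_le_mul x hx y hy
      calc t * dist (g x) (g y) ≤ t * (L * dist x y) := mul_le_mul_of_nonneg_left this ht.1.le
        _ = _ := by rw [hTL, mul_assoc]
    have himg := image_ball_id_add (K := T * L) (by rw [← NNReal.coe_lt_coe, hTL]; exact htL) hlipt
      (fun x hx => by simp [g, hfs x hx]) (fun x hx => by
        have hx1 : ‖x‖ < 1 := by simpa using hx
        have : x + t • g x = (1 - t) • x + t • f x := by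
          simp only [g]; module
        rw [this, mem_ball_zero_iff]
        calc ‖(1 - t) • x + t • f x‖ ≤ ‖(1 - t) • x‖ + ‖t • f x‖ := norm_add_le _ _
          _ = (1 - t) * ‖x‖ + t := by
            rw [norm_smul, norm_smul, hf1 x (hBc hx), Real.norm_of_nonneg ht.1.le,
              Real.norm_of_nonneg (by linarith), mul_one]
          _ < 1 := by nlinarith)
    have hinj : Set.InjOn (fun x => x + t • g x) B := by
      intro x hx y hy hxy
      have h1 := hlipt.dist_le_mul x (hBc hx) y (hBc hy)
      have h2 : dist (t • g x) (t • g y) = dist x y := by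
        rw [dist_eq_norm, dist_eq_norm, ← norm_neg]
        congr 1
        simp only at hxy
        have : x - y = t • g y - t • g x := by
          rw [sub_eq_sub_iff_add_eq_add, hxy, add_comm]
        rw [this]; abel
      rw [h2] at h1
      rw [hTL] at h1
      refine dist_le_zero.1 ?_
      nlinarith [dist_nonneg (x := x) (y := y)]
    have hcov := integral_image_eq_integral_abs_det_fderiv_smul μ (s := B)
      (f := fun x => x + t • g x) (f' := fun x => ContinuousLinearMap.id ℝ E + t • A x)
      measurableSet_ball
      (fun x hx => ((hasFDerivAt_id x).add ((hd x (hBc hx)).const_smul t)).hasFDerivWithinAt)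
      hinj (fun _ => (1 : ℝ))
    rw [himg] at hcov
    simp only [smul_eq_mul, mul_one] at hcov
    rw [setIntegral_const, smul_eq_mul, mul_one] at hcov
    refine Eq.trans (setIntegral_congr_fun measurableSet_ball fun x hx => ?_) hcov.symm
    exact (abs_of_pos (hpos x hx t ht)).symm
  -- interpolation carries the volume identity from small parameters to the parameter `1`
  obtain ⟨τ, c, hτ, hc⟩ := exists_lagrange_weights (Module.finrank ℝ E) (1 / L)
    (one_div_pos.2 hL0)
  have hdet : ∀ x, (ContinuousLinearMap.id ℝ E + (1 : ℝ) • A x).det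
      = ∑ i ∈ Finset.range (Module.finrank ℝ E + 1),
        c i * (ContinuousLinearMap.id ℝ E + τ i • A x).det := by
    intro x
    obtain ⟨q, hq, hqe⟩ := exists_polynomial_det_one_add_smul (A x)
    rw [hqe, hc q hq]
    exact Finset.sum_congr rfl fun i _ => by rw [hqe]
  have hc1 : ∑ i ∈ Finset.range (Module.finrank ℝ E + 1), c i = 1 := by
    have := hc 1 (by simp)
    simpa using this.symm
  have hone : ∫ x in B, (ContinuousLinearMap.id ℝ E + (1 : ℝ) • A x).det ∂μ = μ.real B := by
    simp_rw [hdet]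
    rw [integral_finsetSum _ fun i _ => (hint (τ i)).const_mul _]
    simp_rw [integral_const_mul]
    rw [Finset.sum_congr rfl fun i hi => by rw [hvol (τ i) (hτ i hi)], ← Finset.sum_mul, hc1,
      one_mul]
  have hzero : ∀ x ∈ B, (ContinuousLinearMap.id ℝ E + (1 : ℝ) • A x).det = 0 := by
    intro x hx
    have hA : ContinuousLinearMap.id ℝ E + (1 : ℝ) • A x = fderiv ℝ f x := by
      simp only [A, one_smul]; abel
    rw [hA]
    by_contra hne
    -- differentiate `‖f‖² = 1`: the range of `f'(x)` is orthogonal to `f x`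
    have hsurj : Function.Surjective (fderiv ℝ f x) := by
      have hu : IsUnit (LinearMap.det (fderiv ℝ f x : E →ₗ[ℝ] E)) := isUnit_iff_ne_zero.2 hne
      exact ((Module.End.isUnit_iff _).1 ((LinearMap.isUnit_iff_isUnit_det _).2 hu)).2
    have hfx : HasFDerivAt f (fderiv ℝ f x) x :=
      ((hf.differentiableOn one_ne_zero).differentiableAt
      (hU.mem_nhds (hUB (hBc hx)))).hasFDerivAt
    have h1 := hfx.norm_sq
    have h2 : HasFDerivAt (fun y => ‖f y‖ ^ 2) (0 : E →L[ℝ] ℝ) x := by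
      refine (hasFDerivAt_const (1 : ℝ) x).congr_of_eventuallyEq ?_
      filter_upwards [isOpen_ball.mem_nhds hx] with y hy
      rw [hf1 y (hBc hy)]; norm_num
    have h3 := h1.unique h2
    obtain ⟨v, hv⟩ := hsurj (f x)
    have h4 := congrArg (fun T : E →L[ℝ] ℝ => T v) h3
    simp [hv, hf1 x (hBc hx)] at h4
  rw [setIntegral_congr_fun measurableSet_ball (fun x hx => hzero x hx)] at hone
  simp only [integral_zero] at hone
  have : 0 < μ.real B :=
    ENNReal.toReal_pos (measure_ball_pos μ 0 one_pos).ne' measure_ball_lt_top.ne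
  linarith

/-- A continuously differentiable vector field that points outward on the unit sphere has a zero in
the unit ball: otherwise moving from `x` along the line in the direction of the field until the
sphere is hit is a retraction. -/
theorem exists_zero_of_contDiff_outward {P : E → E} (hP : ContDiff ℝ 1 P)
    (hout : ∀ x, ‖x‖ = 1 → 0 < inner ℝ (P x) x) : ∃ x ∈ closedBall (0 : E) 1, P x = 0 := by
  by_contra! hne
  -- `Δ` is a quarter of the discriminant of the quadratic equation `‖x + s P x‖² = 1` for `s`, and
  -- the function `s` below is its larger root
  let Δ : E → ℝ := fun x => inner ℝ (P x) x ^ 2 + ‖P x‖ ^ 2 * (1 - ‖x‖ ^ 2)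
  have hΔ : ContDiff ℝ 1 Δ := by
    have h1 : ContDiff ℝ 1 fun x => inner ℝ (P x) x := hP.inner ℝ contDiff_id
    have h2 : ContDiff ℝ 1 fun x => ‖P x‖ ^ 2 := hP.norm_sq ℝ
    have h3 : ContDiff ℝ 1 fun x : E => ‖x‖ ^ 2 := contDiff_id.norm_sq ℝ
    exact (h1.pow 2).add (h2.mul (contDiff_const.sub h3))
  let U : Set E := {x | P x ≠ 0} ∩ {x | 0 < Δ x}
  have hU : IsOpen U := (isOpen_ne_fun hP.continuous continuous_const).inter
    (isOpen_lt continuous_const hΔ.continuous)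
  have hΔpos : ∀ x ∈ closedBall (0 : E) 1, 0 < Δ x := by
    intro x hx
    have hx1 : ‖x‖ ≤ 1 := by simpa using hx
    have hPx : 0 < ‖P x‖ := norm_pos_iff.2 (hne x hx)
    rcases hx1.eq_or_lt with h | h
    · simp only [Δ, h]
      have := hout x h
      simp; positivity
    · have : 0 < ‖P x‖ ^ 2 * (1 - ‖x‖ ^ 2) := by
        apply mul_pos (by positivity)
        nlinarith [norm_nonneg x]
      have h2 := sq_nonneg (inner ℝ (P x) x : ℝ)
      simp only [Δ]; linarith
  let s : E → ℝ := fun x => (-inner ℝ (P x) x + √(Δ x)) / ‖P x‖ ^ 2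
  refine not_exists_contDiff_retraction (f := fun x => x + s x • P x) hU
    (fun x hx => ⟨hne x hx, hΔpos x hx⟩) ?_ ?_ ?_
  · refine contDiffOn_id.add (ContDiffOn.smul ?_ hP.contDiffOn)
    refine ContDiffOn.div ?_ ((hP.norm_sq ℝ).contDiffOn) ?_
    · exact ((hP.inner ℝ contDiff_id).neg.contDiffOn).add
        (hΔ.contDiffOn.sqrt fun x hx => hx.2.ne')
    · intro x hx
      have := norm_pos_iff.2 hx.1
      positivity
  · intro x hx
    have hPx : ‖P x‖ ≠ 0 := norm_ne_zero_iff.2 (hne x hx)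
    have hsq : √(Δ x) ^ 2 = Δ x := Real.sq_sqrt (hΔpos x hx).le
    have h1 : ‖x + s x • P x‖ ^ 2 = 1 := by
      rw [norm_add_sq_real, inner_smul_right, norm_smul, mul_pow, Real.norm_eq_abs, sq_abs,
        real_inner_comm]
      simp only [s]
      field_simp
      simp only [Δ] at hsq ⊢
      nlinarith [hsq]
    have h2 : (0:ℝ) ≤ ‖x + s x • P x‖ := norm_nonneg _
    nlinarith
  · intro x hx
    have h := hout x hx
    have : √(Δ x) = inner ℝ (P x) x := by
      simp only [Δ, hx]
      simp [Real.sqrt_sq h.le]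
    simp [s, this]

/-- A continuous vector field that points outward on a sphere around the origin vanishes somewhere
in the ball. -/
theorem exists_zero_of_continuous_outward {Φ : E → E} (hΦ : Continuous Φ) {R : ℝ} (hR : 0 < R)
    (hout : ∀ x, ‖x‖ = R → 0 < inner ℝ (Φ x) x) : ∃ x, Φ x = 0 := by
  by_contra! hne
  let Ψ : E → E := fun x => Φ (R • x)
  have hΨ : Continuous Ψ := hΦ.comp (continuous_const_smul R)
  have hΨo : ∀ x, ‖x‖ = 1 → 0 < inner ℝ (Ψ x) x := by
    intro x hx
    have h := hout (R • x) (by rw [norm_smul, hx, mul_one, Real.norm_of_nonneg hR.le])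
    rw [inner_smul_right] at h
    exact (mul_pos_iff_of_pos_left hR).1 h
  obtain ⟨m, hm, hm'⟩ : ∃ m > 0, ∀ x ∈ sphere (0 : E) 1, m ≤ inner ℝ (Ψ x) x := by
    rcases (sphere (0 : E) 1).eq_empty_or_nonempty with h | h
    · exact ⟨1, one_pos, by simp [h]⟩
    · obtain ⟨x, hx, hmin⟩ := (isCompact_sphere (0 : E) 1).exists_isMinOn h
        (f := fun x => inner ℝ (Ψ x) x) (hΨ.inner continuous_id).continuousOn
      exact ⟨_, hΨo x (by simpa using hx), fun y hy => hmin hy⟩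
  obtain ⟨k, hk, hk'⟩ : ∃ k > 0, ∀ x ∈ closedBall (0 : E) 1, k ≤ ‖Ψ x‖ := by
    obtain ⟨x, hx, hmin⟩ := (isCompact_closedBall (0 : E) 1).exists_isMinOn
      ⟨0, by simp⟩ (f := fun x => ‖Ψ x‖) hΨ.norm.continuousOn
    exact ⟨_, norm_pos_iff.2 (hne _), fun y hy => hmin hy⟩
  obtain ⟨P, hPs, hPa, -⟩ := hΨ.exists_contDiff_approx 1
    (ε := fun _ => min m k) continuous_const (fun _ => lt_min hm hk)
  obtain ⟨x, hx, hx0⟩ := exists_zero_of_contDiff_outward (P := P) (by exact_mod_cast hPs) (by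
    intro x hx
    have h1 := hm' x (by simpa using hx)
    have h2 : ‖Ψ x - P x‖ < m := by
      rw [← dist_eq_norm, dist_comm]; exact (hPa x).trans_le (min_le_left _ _)
    have h3 := real_inner_le_norm (Ψ x - P x) x
    rw [hx, mul_one, inner_sub_left] at h3
    linarith)
  have h := hPa x
  rw [hx0, dist_zero_left] at h
  exact absurd (hk' x hx) (not_le.2 (h.trans_le (min_le_right _ _)))

end Zeros

/-! ### Slicing by parallel hyperplanes -/

section Slicing

variable {d : ℕ}

theorem finrank_orthogonal_span_unit {n : Pt d} (hn : ‖n‖ = 1) :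
    Module.finrank ℝ (ℝ ∙ n)ᗮ = d - 1 := by
  have h1 := (ℝ ∙ n).finrank_add_finrank_orthogonal
  have hn0 : n ≠ 0 := by rintro rfl; simp at hn
  rw [finrank_span_singleton hn0, finrank_euclideanSpace_fin] at h1
  omega

/-- The isometric parametrization of the hyperplane `⟨n, x⟩ = c` by the orthogonal complement of the
unit vector `n`. -/
def hyperplaneMap (n : Pt d) (c : ℝ) (y : (ℝ ∙ n)ᗮ) : Pt d := y + c • n

theorem isometry_hyperplaneMap (n : Pt d) (c : ℝ) : Isometry (hyperplaneMap n c) :=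
  Isometry.of_dist_eq fun x y => by simp [hyperplaneMap, dist_add_right, Subtype.dist_eq]

theorem inner_hyperplaneMap {n : Pt d} (hn : ‖n‖ = 1) (c : ℝ) (y : (ℝ ∙ n)ᗮ) :
    inner ℝ n (hyperplaneMap n c y) = c := by
  have h := Submodule.mem_orthogonal_singleton_iff_inner_right.1 y.2
  rw [hyperplaneMap, inner_add_right, inner_smul_right, h, real_inner_self_eq_norm_sq, hn]
  simp

theorem range_hyperplaneMap {n : Pt d} (hn : ‖n‖ = 1) (c : ℝ) :
    Set.range (hyperplaneMap n c) = {x | inner ℝ n x = c} := by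
  ext x
  refine ⟨?_, fun hx => ?_⟩
  · rintro ⟨y, rfl⟩
    exact inner_hyperplaneMap hn c y
  · have hx' : inner ℝ n x = c := hx
    refine ⟨⟨x - c • n, Submodule.mem_orthogonal_singleton_iff_inner_right.2 ?_⟩, ?_⟩
    · rw [inner_sub_right, inner_smul_right, real_inner_self_eq_norm_sq, hn, hx']
      simp
    · simp [hyperplaneMap]

/-- The surface measure of a hyperplane is the image of the Lebesgue measure. -/
theorem map_hyperplaneMap_volume {n : Pt d} (hn : ‖n‖ = 1) (c : ℝ) :
    (volume : Measure (ℝ ∙ n)ᗮ).map (hyperplaneMap n c)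
      = (μHE[d - 1] : Measure (Pt d)).restrict {x | inner ℝ n x = c} := by
  rw [← range_hyperplaneMap hn c, ← (isometry_hyperplaneMap n c).map_euclideanHausdorffMeasure,
    ← finrank_orthogonal_span_unit hn, InnerProductSpace.euclideanHausdorffMeasure_eq_volume]

theorem measurableEmbedding_hyperplaneMap (n : Pt d) (c : ℝ) :
    MeasurableEmbedding (hyperplaneMap n c) :=
  (isometry_hyperplaneMap n c).isClosedEmbedding.measurableEmbedding

/-- A bounded part of a hyperplane has finite surface measure. -/
theorem hausdorff_hyperplane_lt_top {n : Pt d} (hn : ‖n‖ = 1) (c : ℝ) {F : Set (Pt d)}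
    (hF : Bornology.IsBounded F) (hFc : F ⊆ {x | inner ℝ n x = c}) :
    (μHE[d - 1] : Measure (Pt d)) F < ⊤ := by
  have h1 : (μHE[d - 1] : Measure (Pt d)) F
      = (μHE[d - 1] : Measure (Pt d)).restrict {x | inner ℝ n x = c} F := by
    rw [Measure.restrict_eq_self _ hFc]
  rw [h1, ← map_hyperplaneMap_volume hn c, (measurableEmbedding_hyperplaneMap n c).map_apply]
  exact ((isometry_hyperplaneMap n c).antilipschitz.isBounded_preimage hF).measure_lt_top

theorem setIntegral_hyperplane {n : Pt d} (hn : ‖n‖ = 1) (c : ℝ) {F : Set (Pt d)}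
    (hF : MeasurableSet F) (g : Pt d → ℝ) :
    ∫ x in {x ∈ F | inner ℝ n x = c}, g x ∂μHE[d - 1]
      = ∫ y : (ℝ ∙ n)ᗮ, F.indicator g (hyperplaneMap n c y) := by
  have h1 : {x ∈ F | inner ℝ n x = c} = F ∩ {x | inner ℝ n x = c} := rfl
  rw [h1, ← Measure.restrict_restrict hF, ← map_hyperplaneMap_volume hn c,
    ← integral_indicator hF, (measurableEmbedding_hyperplaneMap n c).integral_map]

/-- Cartesian coordinates along and across the unit vector `n`. -/
noncomputable def sliceEquiv {n : Pt d} (hn : ‖n‖ = 1) : Pt d ≃ᵐ ℝ × (ℝ ∙ n)ᗮ :=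
  ((ℝ ∙ n).measurableEquivProd (0 : Pt d)).trans
    (MeasurableEquiv.prodCongr
      (LinearIsometryEquiv.toSpanUnitSingleton (𝕜 := ℝ) n hn).symm.toMeasurableEquiv
      (MeasurableEquiv.refl _))

theorem measurePreserving_sliceEquiv {n : Pt d} (hn : ‖n‖ = 1) :
    MeasurePreserving (sliceEquiv hn) volume volume := by
  have h1 := (ℝ ∙ n).measurePreserving_measurableEquivProd (0 : Pt d)
  rw [InnerProductSpace.euclideanHausdorffMeasure_eq_volume] at h1
  exact h1.trans
    (((LinearIsometryEquiv.toSpanUnitSingleton (𝕜 := ℝ) n hn).symm.measurePreserving).prod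
      (MeasurePreserving.id _))

theorem sliceEquiv_symm_apply {n : Pt d} (hn : ‖n‖ = 1) (z : ℝ × (ℝ ∙ n)ᗮ) :
    (sliceEquiv hn).symm z = hyperplaneMap n z.1 z.2 := by
  have h : (sliceEquiv hn).symm z = ((ℝ ∙ n).measurableEquivProd (0 : Pt d)).symm
      (LinearIsometryEquiv.toSpanUnitSingleton (𝕜 := ℝ) n hn z.1, z.2) := rfl
  rw [h, Submodule.measurableEquivProd_symm_apply]
  simp [hyperplaneMap, add_comm]

theorem integral_eq_integral_hyperplaneMap {n : Pt d} (hn : ‖n‖ = 1) (f : Pt d → ℝ) :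
    ∫ x, f x = ∫ z : ℝ × (ℝ ∙ n)ᗮ, f (hyperplaneMap n z.1 z.2) := by
  simp_rw [← sliceEquiv_symm_apply hn]
  exact ((measurePreserving_sliceEquiv hn).symm.integral_comp' f).symm

/-- Stretching the layer below the hyperplane `⟨n, x⟩ = c` by the factor `1 / δ`. -/
theorem integral_eq_integral_stretched {n : Pt d} (hn : ‖n‖ = 1) (f : Pt d → ℝ) (c : ℝ) {δ : ℝ}
    (hδ : 0 < δ) :
    ∫ x, f x = δ * ∫ z : ℝ × (ℝ ∙ n)ᗮ, f (hyperplaneMap n (c - δ * z.1) z.2) := by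
  let A : ℝ ≃ₜ ℝ := (Homeomorph.mulLeft₀ δ hδ.ne').trans (Homeomorph.subLeft c)
  have hA : ∀ t, A t = c - δ * t := fun t => rfl
  have hmap : (volume : Measure ℝ).map A = ENNReal.ofReal δ⁻¹ • volume := by
    have h1 : (A : ℝ → ℝ) = (fun t => c - t) ∘ (fun t => δ * t) := rfl
    rw [h1, ← Measure.map_map (by fun_prop) (by fun_prop), Real.map_volume_mul_left hδ.ne',
      Measure.map_smul, (Measure.measurePreserving_sub_left (volume : Measure ℝ) c).map_eq,
      abs_of_pos (inv_pos.2 hδ)]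
  have hmap2 : (volume : Measure (ℝ × (ℝ ∙ n)ᗮ)).map
      (Prod.map A id) = ENNReal.ofReal δ⁻¹ • volume := by
    rw [Measure.volume_eq_prod, ← Measure.map_prod_map _ _ A.measurable measurable_id, hmap,
      Measure.map_id, Measure.prod_smul_left]
  have hemb : MeasurableEmbedding (Prod.map A (id : (ℝ ∙ n)ᗮ → (ℝ ∙ n)ᗮ)) :=
    A.measurableEmbedding.prodMap MeasurableEmbedding.id
  have h2 := hemb.integral_map (μ := volume) (fun z => f (hyperplaneMap n z.1 z.2))
  rw [hmap2, integral_smul_measure, ENNReal.toReal_ofReal (inv_pos.2 hδ).le] at h2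
  have h3 : ∫ z : ℝ × (ℝ ∙ n)ᗮ, f (hyperplaneMap n (c - δ * z.1) z.2)
      = δ⁻¹ • ∫ z : ℝ × (ℝ ∙ n)ᗮ, f (hyperplaneMap n z.1 z.2) := h2.symm
  rw [h3, integral_eq_integral_hyperplaneMap hn, smul_eq_mul, mul_inv_cancel_left₀ hδ.ne']

/-- Two hyperplanes with unit normals `n ≠ m` bounding half-spaces with a common interior point meet
in a null set. -/
theorem volume_hyperplane_inter {n m : Pt d} (hn : ‖n‖ = 1) (hm : ‖m‖ = 1) (hnm : m ≠ n)
    {a b : ℝ} {x₀ : Pt d} (hxn : inner ℝ n x₀ < a) (hxm : inner ℝ m x₀ < b) :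
    volume {y : (ℝ ∙ n)ᗮ | inner ℝ m (hyperplaneMap n a y) = b} = 0 := by
  rcases Set.eq_empty_or_nonempty {y : (ℝ ∙ n)ᗮ | inner ℝ m (hyperplaneMap n a y) = b}
    with he | ⟨y₀, hy₀⟩
  · rw [he, measure_empty]
  let L : (ℝ ∙ n)ᗮ →ₗ[ℝ] ℝ := (innerₛₗ ℝ m) ∘ₗ (ℝ ∙ n)ᗮ.subtype
  have hL : ∀ y : (ℝ ∙ n)ᗮ, L y = inner ℝ m (y : Pt d) := fun y => rfl
  have hker : LinearMap.ker L ≠ ⊤ := by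
    intro htop
    have hmem : m ∈ (ℝ ∙ n)ᗮᗮ := by
      rw [Submodule.mem_orthogonal']
      intro u hu
      have : (⟨u, hu⟩ : (ℝ ∙ n)ᗮ) ∈ LinearMap.ker L := htop ▸ Submodule.mem_top
      exact this
    rw [Submodule.orthogonal_orthogonal] at hmem
    obtain ⟨c, rfl⟩ := Submodule.mem_span_singleton.1 hmem
    rw [norm_smul, hn, mul_one, Real.norm_eq_abs] at hm
    -- `m = -n` is excluded: parallel hyperplanes with a common point coincide, and the open
    -- half-spaces on their two sides are disjoint
    rcases eq_or_eq_neg_of_abs_eq hm with rfl | rfl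
    · exact hnm (one_smul _ _)
    · have h1 : inner ℝ ((-1 : ℝ) • n) (hyperplaneMap n a y₀) = b := hy₀
      rw [inner_smul_left, inner_hyperplaneMap hn] at h1
      rw [inner_smul_left] at hxm
      simp at h1 hxm
      linarith
  have hsub : {y : (ℝ ∙ n)ᗮ | inner ℝ m (hyperplaneMap n a y) = b}
      ⊆ (AffineSubspace.mk' y₀ (LinearMap.ker L) : Set (ℝ ∙ n)ᗮ) := by
    intro y hy
    rw [SetLike.mem_coe, AffineSubspace.mem_mk', LinearMap.mem_ker, vsub_eq_sub, map_sub, hL, hL]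
    have h1 : inner ℝ m (hyperplaneMap n a y) = b := hy
    have h2 : inner ℝ m (hyperplaneMap n a y₀) = b := hy₀
    simp only [hyperplaneMap, inner_add_right] at h1 h2
    linarith
  refine measure_mono_null hsub (Measure.addHaar_affineSubspace _ _ fun htop => hker ?_)
  rw [← AffineSubspace.direction_mk' y₀ (LinearMap.ker L), htop, AffineSubspace.direction_top]

end Slicing

/-! ### The boundary layer of a convex polytope -/

section Layer

open Filter Topology

variable {d : ℕ}

theorem deriv_smoothTransition_of_nonpos {x : ℝ} (hx : x ≤ 0) :
    deriv Real.smoothTransition x = 0 := by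
  refine IsLocalMin.deriv_eq_zero (Eventually.of_forall fun y => ?_)
  rw [Real.smoothTransition.zero_of_nonpos hx]
  exact Real.smoothTransition.nonneg y

theorem deriv_smoothTransition_of_one_le {x : ℝ} (hx : 1 ≤ x) :
    deriv Real.smoothTransition x = 0 := by
  refine IsLocalMax.deriv_eq_zero (Eventually.of_forall fun y => ?_)
  rw [Real.smoothTransition.one_of_one_le hx]
  exact Real.smoothTransition.le_one y

theorem continuous_deriv_smoothTransition : Continuous (deriv Real.smoothTransition) :=
  (Real.smoothTransition.contDiff (n := 1)).continuous_deriv le_rfl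

theorem exists_bound_deriv_smoothTransition :
    ∃ C : ℝ, 0 ≤ C ∧ ∀ x, |deriv Real.smoothTransition x| ≤ C := by
  obtain ⟨C, hC⟩ := isCompact_Icc.exists_bound_of_continuousOn (s := Set.Icc (0 : ℝ) 1)
    continuous_deriv_smoothTransition.continuousOn
  have hC0 : 0 ≤ C := (norm_nonneg _).trans (hC 0 (by simp))
  refine ⟨C, hC0, fun x => ?_⟩
  rcases le_total x 0 with h | h
  · rw [deriv_smoothTransition_of_nonpos h, abs_zero]; exact hC0
  rcases le_total 1 x with h' | h'
  · rw [deriv_smoothTransition_of_one_le h', abs_zero]; exact hC0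
  exact hC x ⟨h, h'⟩

theorem integral_deriv_smoothTransition :
    ∫ t, deriv Real.smoothTransition (t - 1) = 1 := by
  rw [integral_sub_right_eq_self (deriv Real.smoothTransition) 1]
  have h1 : ∫ t, deriv Real.smoothTransition t
      = ∫ t in Set.Ioc (0 : ℝ) 1, deriv Real.smoothTransition t := by
    refine (setIntegral_eq_integral_of_forall_compl_eq_zero fun t ht => ?_).symm
    rcases le_or_gt t 0 with h | h
    · exact deriv_smoothTransition_of_nonpos h
    · refine deriv_smoothTransition_of_one_le (le_of_not_ge fun h' => ht ⟨h, h'⟩)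
  rw [h1, ← intervalIntegral.integral_of_le zero_le_one,
    intervalIntegral.integral_deriv_eq_sub
      (fun x _ => (Real.smoothTransition.contDiff (n := 1)).differentiable one_ne_zero x)
      (continuous_deriv_smoothTransition.intervalIntegrable _ _),
    Real.smoothTransition.one, Real.smoothTransition.zero, sub_zero]

/-- The smooth ramp of the signed distance to the hyperplane `⟨m, x⟩ = h m`: zero up to distance `δ`
inside the half-space `⟨m, x⟩ ≤ h m`, and one from distance `2 δ` on. -/
noncomputable def ramp (h : Pt d → ℝ) (δ : ℝ) (m x : Pt d) : ℝ :=
  Real.smoothTransition ((h m - inner ℝ m x) / δ - 1)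

theorem ramp_nonneg (h : Pt d → ℝ) (δ : ℝ) (m x : Pt d) : 0 ≤ ramp h δ m x :=
  Real.smoothTransition.nonneg _

theorem ramp_le_one (h : Pt d → ℝ) (δ : ℝ) (m x : Pt d) : ramp h δ m x ≤ 1 :=
  Real.smoothTransition.le_one _

theorem contDiff_ramp (h : Pt d → ℝ) (δ : ℝ) (m : Pt d) : ContDiff ℝ ∞ (ramp h δ m) := by
  refine Real.smoothTransition.contDiff.comp ?_
  exact ((contDiff_const.sub (contDiff_const.inner ℝ contDiff_id)).div_const _).sub contDiff_const

theorem ramp_eq_zero {h : Pt d → ℝ} {δ : ℝ} (hδ : 0 < δ) {m x : Pt d}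
    (hx : h m - inner ℝ m x ≤ δ) : ramp h δ m x = 0 := by
  refine Real.smoothTransition.zero_of_nonpos ?_
  rw [sub_nonpos, div_le_one hδ]; exact hx

theorem ramp_eq_one {h : Pt d → ℝ} {δ : ℝ} (hδ : 0 < δ) {m x : Pt d}
    (hx : 2 * δ ≤ h m - inner ℝ m x) : ramp h δ m x = 1 := by
  refine Real.smoothTransition.one_of_one_le ?_
  have : 2 ≤ (h m - inner ℝ m x) / δ := by rwa [le_div_iff₀ hδ]
  linarith

/-- The layer of width `δ` along one facet of a polytope, weighted by the derivative of the ramp,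
concentrates on the facet as `δ → 0`: the other ramps tend to one in the relative interior of the
facet, and the relative boundary is a null set. -/
theorem tendsto_boundary_layer [DecidableEq (Pt d)] {S : Finset (Pt d)} {h : Pt d → ℝ}
    {K : Set (Pt d)} (hK : IsCompact K) (hS : ∀ m ∈ S, ‖m‖ = 1)
    (hKS : K = {x | ∀ m ∈ S, inner ℝ m x ≤ h m}) {x₀ : Pt d} (hx₀ : ∀ m ∈ S, inner ℝ m x₀ < h m)
    {n : Pt d} (hnS : n ∈ S) {G : Pt d → ℝ} (hG : ContinuousOn G K) :
    Tendsto (fun δ : ℝ => δ⁻¹ * ∫ x in K, G x *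
        (deriv Real.smoothTransition ((h n - inner ℝ n x) / δ - 1) *
          ∏ m ∈ S.erase n, ramp h δ m x))
      (𝓝[>] 0) (𝓝 (∫ x in {x ∈ K | inner ℝ n x = h n}, G x ∂μHE[d - 1])) := by
  have hn : ‖n‖ = 1 := hS n hnS
  have hKm : MeasurableSet K := hK.isClosed.measurableSet
  obtain ⟨CG, hCG⟩ := hK.exists_bound_of_continuousOn hG
  obtain ⟨CD, hCD0, hCD⟩ := exists_bound_deriv_smoothTransition
  obtain ⟨R, hR⟩ := hK.isBounded.exists_norm_le
  -- the integrand of the stretched layer and its limit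
  let F : ℝ → ℝ × (ℝ ∙ n)ᗮ → ℝ := fun δ z =>
    K.indicator G (hyperplaneMap n (h n - δ * z.1) z.2) *
      (deriv Real.smoothTransition (z.1 - 1) *
        ∏ m ∈ S.erase n, ramp h δ m (hyperplaneMap n (h n - δ * z.1) z.2))
  let F₀ : ℝ × (ℝ ∙ n)ᗮ → ℝ := fun z =>
    deriv Real.smoothTransition (z.1 - 1) * K.indicator G (hyperplaneMap n (h n) z.2)
  have hlim : ∫ z, F₀ z = ∫ x in {x ∈ K | inner ℝ n x = h n}, G x ∂μHE[d - 1] := by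
    rw [setIntegral_hyperplane hn (h n) hKm]
    simp only [F₀]
    rw [Measure.volume_eq_prod, integral_prod_mul (fun t => deriv Real.smoothTransition (t - 1))
      (fun y => K.indicator G (hyperplaneMap n (h n) y)), integral_deriv_smoothTransition, one_mul]
  have hstretch : ∀ δ : ℝ, 0 < δ → ∫ z, F δ z = δ⁻¹ * ∫ x in K, G x *
        (deriv Real.smoothTransition ((h n - inner ℝ n x) / δ - 1) *
          ∏ m ∈ S.erase n, ramp h δ m x) := by
    intro δ hδ
    rw [← integral_indicator hKm, integral_eq_integral_stretched hn _ (h n) hδ,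
      inv_mul_cancel_left₀ hδ.ne']
    refine integral_congr_ae (Eventually.of_forall fun z => ?_)
    simp only [F]
    by_cases hz : hyperplaneMap n (h n - δ * z.1) z.2 ∈ K
    · simp only [Set.indicator_of_mem hz]
      rw [inner_hyperplaneMap hn, sub_sub_cancel, mul_div_cancel_left₀ _ hδ.ne']
    · simp only [Set.indicator_of_notMem hz, zero_mul]
  rw [← hlim]
  refine Tendsto.congr' (f₁ := fun δ => ∫ z, F δ z) ?_ ?_
  · filter_upwards [self_mem_nhdsWithin] with δ hδ using hstretch δ hδ
  have hnorm : ∀ (c : ℝ) (y : (ℝ ∙ n)ᗮ), ‖y‖ ≤ ‖hyperplaneMap n c y‖ := by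
    intro c y
    have h1 : ‖hyperplaneMap n c y‖ ^ 2 = ‖y‖ ^ 2 + c ^ 2 := by
      have horth := Submodule.mem_orthogonal_singleton_iff_inner_left.1 y.2
      rw [hyperplaneMap, norm_add_sq_real, inner_smul_right, horth, norm_smul, hn]
      simp
    refine le_of_sq_le_sq ?_ (norm_nonneg _)
    nlinarith [sq_nonneg c]
  have hGind : Measurable (K.indicator G) := by
    classical
    rw [← Set.piecewise_eq_indicator]
    exact hG.measurable_piecewise continuousOn_const hKm
  have hCG0 : 0 ≤ CG :=
    (norm_nonneg _).trans (hCG x₀ (by rw [hKS]; exact fun m hm => (hx₀ m hm).le))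
  have hCGi : ∀ x, ‖K.indicator G x‖ ≤ CG := by
    intro x
    by_cases hx : x ∈ K
    · rw [Set.indicator_of_mem hx]; exact hCG x hx
    · rw [Set.indicator_of_notMem hx, norm_zero]; exact hCG0
  have hhyp : ∀ δ : ℝ, Continuous fun z : ℝ × (ℝ ∙ n)ᗮ => hyperplaneMap n (h n - δ * z.1) z.2 := by
    intro δ; unfold hyperplaneMap; fun_prop
  let B : Set (ℝ × (ℝ ∙ n)ᗮ) := Set.Icc 1 2 ×ˢ Metric.closedBall 0 R
  refine tendsto_integral_filter_of_dominated_convergence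
    (B.indicator fun _ => CG * CD) ?_ ?_ ?_ ?_
  · refine Eventually.of_forall fun δ => Measurable.aestronglyMeasurable ?_
    refine (hGind.comp (hhyp δ).measurable).mul (((continuous_deriv_smoothTransition.comp
      (by fun_prop)).mul (continuous_finsetProd _ fun m _ =>
        (contDiff_ramp h δ m).continuous.comp (hhyp δ))).measurable)
  · refine Eventually.of_forall fun δ => Eventually.of_forall fun z => ?_
    by_cases hz : z ∈ B
    · rw [Set.indicator_of_mem hz]
      simp only [F]
      rw [norm_mul, norm_mul]
      have h1 : ‖∏ m ∈ S.erase n, ramp h δ m (hyperplaneMap n (h n - δ * z.1) z.2)‖ ≤ 1 := by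
        rw [Real.norm_of_nonneg (Finset.prod_nonneg fun m _ => ramp_nonneg _ _ _ _)]
        exact Finset.prod_le_one (fun m _ => ramp_nonneg _ _ _ _) fun m _ => ramp_le_one _ _ _ _
      have h2 : ‖deriv Real.smoothTransition (z.1 - 1)‖ ≤ CD := hCD _
      exact mul_le_mul (hCGi _) ((mul_le_mul h2 h1 (norm_nonneg _) hCD0).trans_eq (mul_one _))
        (by positivity) hCG0
    · rw [Set.indicator_of_notMem hz, norm_le_zero_iff]
      simp only [F]
      by_cases hzK : hyperplaneMap n (h n - δ * z.1) z.2 ∈ K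
      · have hd0 : deriv Real.smoothTransition (z.1 - 1) = 0 := by
          by_contra hne
          refine hz ⟨⟨?_, ?_⟩, ?_⟩
          · by_contra hlt
            exact hne (deriv_smoothTransition_of_nonpos (by linarith))
          · by_contra hlt
            exact hne (deriv_smoothTransition_of_one_le (by linarith))
          · rw [mem_closedBall_zero_iff]
            exact (hnorm _ _).trans (hR _ hzK)
        rw [hd0, zero_mul, mul_zero]
      · rw [Set.indicator_of_notMem hzK, zero_mul]
  · rw [integrable_indicator_iff (measurableSet_Icc.prod Metric.isClosed_closedBall.measurableSet)]
    exact integrableOn_const ((isCompact_Icc.prod (isCompact_closedBall 0 R)).measure_lt_top.ne)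
  · have hnull : ∀ᵐ y : (ℝ ∙ n)ᗮ, ∀ m ∈ S.erase n, inner ℝ m (hyperplaneMap n (h n) y) ≠ h m := by
      rw [Filter.eventually_all_finset]
      intro m hm
      have h1 := volume_hyperplane_inter hn (hS m (Finset.mem_of_mem_erase hm))
        (Finset.ne_of_mem_erase hm) (hx₀ n hnS) (hx₀ m (Finset.mem_of_mem_erase hm))
      rw [ae_iff]
      simpa using h1
    have hnull2 : ∀ᵐ z : ℝ × (ℝ ∙ n)ᗮ,
        ∀ m ∈ S.erase n, inner ℝ m (hyperplaneMap n (h n) z.2) ≠ h m :=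
      Measure.quasiMeasurePreserving_snd.ae hnull
    filter_upwards [hnull2] with z hz
    rcases le_or_gt z.1 1 with ht | ht
    · have : deriv Real.smoothTransition (z.1 - 1) = 0 :=
        deriv_smoothTransition_of_nonpos (by linarith)
      simp only [F, F₀, this, zero_mul, mul_zero]
      exact tendsto_const_nhds
    have hpath : Tendsto (fun δ : ℝ => hyperplaneMap n (h n - δ * z.1) z.2) (𝓝[>] 0)
        (𝓝 (hyperplaneMap n (h n) z.2)) := by
      have : Continuous fun δ : ℝ => hyperplaneMap n (h n - δ * z.1) z.2 := by
        unfold hyperplaneMap; fun_prop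
      have h2 := this.tendsto 0
      simp only [zero_mul, sub_zero] at h2
      exact h2.mono_left nhdsWithin_le_nhds
    have hin : ∀ m : Pt d, Tendsto (fun δ : ℝ => inner ℝ m (hyperplaneMap n (h n - δ * z.1) z.2))
        (𝓝[>] 0) (𝓝 (inner ℝ m (hyperplaneMap n (h n) z.2))) := fun m =>
      tendsto_const_nhds.inner hpath
    by_cases hall : ∀ m ∈ S.erase n, inner ℝ m (hyperplaneMap n (h n) z.2) < h m
    · -- relative interior of the facet
      have hmem₀ : hyperplaneMap n (h n) z.2 ∈ K := by
        rw [hKS]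
        intro m hm
        by_cases hmn : m = n
        · subst hmn; rw [inner_hyperplaneMap hn]
        · exact (hall m (Finset.mem_erase.2 ⟨hmn, hm⟩)).le
      have hev : ∀ᶠ δ : ℝ in 𝓝[>] 0, ∀ m ∈ S.erase n,
          2 * δ ≤ h m - inner ℝ m (hyperplaneMap n (h n - δ * z.1) z.2) := by
        rw [Filter.eventually_all_finset]
        intro m hm
        have h1 : Tendsto
            (fun δ : ℝ => h m - inner ℝ m (hyperplaneMap n (h n - δ * z.1) z.2) - 2 * δ)
            (𝓝[>] 0) (𝓝 (h m - inner ℝ m (hyperplaneMap n (h n) z.2) - 2 * 0)) :=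
          (tendsto_const_nhds.sub (hin m)).sub
            ((tendsto_id.mono_left nhdsWithin_le_nhds).const_mul 2)
        have h2 := h1.eventually (lt_mem_nhds (a := 0) (by linarith [hall m hm]))
        filter_upwards [h2] with δ hδ using by linarith
      have hmem : ∀ᶠ δ : ℝ in 𝓝[>] 0, hyperplaneMap n (h n - δ * z.1) z.2 ∈ K := by
        filter_upwards [hev, self_mem_nhdsWithin] with δ hδ hδ0
        have hδ0' : 0 < δ := hδ0
        rw [hKS]
        intro m hm
        by_cases hmn : m = n
        · subst hmn; rw [inner_hyperplaneMap hn]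
          have : 0 < δ * z.1 := mul_pos hδ0' (by linarith)
          linarith
        · have := hδ m (Finset.mem_erase.2 ⟨hmn, hm⟩)
          linarith
      have hGlim : Tendsto (fun δ : ℝ => G (hyperplaneMap n (h n - δ * z.1) z.2)) (𝓝[>] 0)
          (𝓝 (G (hyperplaneMap n (h n) z.2))) :=
        (hG _ hmem₀).tendsto.comp (tendsto_nhdsWithin_iff.2 ⟨hpath, hmem⟩)
      have hF₀ : F₀ z = G (hyperplaneMap n (h n) z.2) * deriv Real.smoothTransition (z.1 - 1) := by
        simp only [F₀, Set.indicator_of_mem hmem₀, mul_comm]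
      rw [hF₀]
      refine (hGlim.mul_const _).congr' ?_
      filter_upwards [hev, hmem, self_mem_nhdsWithin] with δ h1 h2 h3
      simp only [F, Set.indicator_of_mem h2]
      rw [Finset.prod_eq_one fun m hm => ramp_eq_one h3 (h1 m hm), mul_one]
    · -- points of the hyperplane outside the facet
      push Not at hall
      obtain ⟨m, hm, hmz⟩ := hall
      have hlt : h m < inner ℝ m (hyperplaneMap n (h n) z.2) := lt_of_le_of_ne hmz (hz m hm).symm
      have hout : ∀ x : Pt d, h m < inner ℝ m x → x ∉ K := by
        intro x hx hxK
        rw [hKS] at hxK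
        exact absurd (hxK m (Finset.mem_of_mem_erase hm)) (not_le.2 hx)
      have hF₀ : F₀ z = 0 := by
        simp only [F₀, Set.indicator_of_notMem (hout _ hlt), mul_zero]
      rw [hF₀]
      refine tendsto_const_nhds.congr' ?_
      filter_upwards [(hin m).eventually (lt_mem_nhds hlt)] with δ hδ
      simp only [F, Set.indicator_of_notMem (hout _ hδ), zero_mul]

end Layer

/-! ### The divergence theorem on a convex polytope -/

section Divergence

open Filter Topology

variable {d : ℕ}

theorem inner_gradient_right (f : Pt d → ℝ) (x v : Pt d) :
    inner ℝ v (∇ f x) = fderiv ℝ f x v := by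
  rw [real_inner_comm, gradient, InnerProductSpace.toDual_symm_apply]

theorem inner_lt_of_mem_interior {K : Set (Pt d)} {m : Pt d} (hm : ‖m‖ = 1) {c : ℝ}
    (hK : ∀ x ∈ K, inner ℝ m x ≤ c) {x : Pt d} (hx : x ∈ interior K) : inner ℝ m x < c := by
  obtain ⟨r, hr, hball⟩ := Metric.isOpen_iff.1 isOpen_interior x hx
  have h1 : x + (r / 2) • m ∈ K := by
    refine interior_subset (hball ?_)
    rw [Metric.mem_ball, dist_self_add_left, norm_smul, hm, Real.norm_of_nonneg (by positivity)]
    linarith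
  have h2 := hK _ h1
  rw [inner_add_right, inner_smul_right, real_inner_self_eq_norm_sq, hm] at h2
  linarith

/-- The boundary of a convex set is a null set, so only the interior has to lie in `Ω`. -/
theorem memLp_restrict_of_interior_subset {Ω K : Set (Pt d)} (hconv : Convex ℝ K)
    (hKΩ : interior K ⊆ Ω) {p : ENNReal} {f : Pt d → ℝ}
    (hf : MemLp f p (volume.restrict Ω)) :
    MemLp f p (volume.restrict K) := by
  have h1 : (interior K : Set (Pt d)) =ᵐ[volume] K :=
    hconv.addHaar_frontier volume |> interior_ae_eq_of_null_frontier
  rw [← Measure.restrict_congr_set h1]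
  exact hf.mono_measure (Measure.restrict_mono hKΩ le_rfl)

/-- A smooth approximation of the indicator function of the polytope `⋂ m ∈ S, {⟨m, x⟩ ≤ h m}`, with
compact support in its interior. -/
noncomputable def cutoff (S : Finset (Pt d)) (h : Pt d → ℝ) (δ : ℝ) (x : Pt d) : ℝ :=
  ∏ m ∈ S, ramp h δ m x

theorem contDiff_cutoff (S : Finset (Pt d)) (h : Pt d → ℝ) (δ : ℝ) :
    ContDiff ℝ ∞ (cutoff S h δ) :=
  contDiff_prod fun m _ => contDiff_ramp h δ m

theorem cutoff_eq_zero {S : Finset (Pt d)} {h : Pt d → ℝ} {δ : ℝ} (hδ : 0 < δ) {m x : Pt d}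
    (hm : m ∈ S) (hx : h m - inner ℝ m x ≤ δ) : cutoff S h δ x = 0 :=
  Finset.prod_eq_zero hm (ramp_eq_zero hδ hx)

theorem fderiv_ramp (h : Pt d → ℝ) (δ : ℝ) (m x v : Pt d) :
    fderiv ℝ (ramp h δ m) x v
      = -(δ⁻¹ * (inner ℝ m v * deriv Real.smoothTransition ((h m - inner ℝ m x) / δ - 1))) := by
  have h1 : HasFDerivAt (fun x : Pt d => (h m - inner ℝ m x) / δ - 1)
      ((δ⁻¹ : ℝ) • (-(innerSL ℝ m))) x := by
    have h2 : HasFDerivAt (fun x : Pt d => inner ℝ m x) (innerSL ℝ m) x := (innerSL ℝ m).hasFDerivAt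
    have h3 := ((h2.const_sub (h m)).const_mul δ⁻¹).sub_const 1
    refine h3.congr_of_eventuallyEq (Eventually.of_forall fun y => ?_)
    simp only [div_eq_inv_mul]
  have h4 : HasDerivAt Real.smoothTransition
      (deriv Real.smoothTransition ((h m - inner ℝ m x) / δ - 1)) ((h m - inner ℝ m x) / δ - 1) :=
    ((Real.smoothTransition.contDiff (n := 1)).differentiable one_ne_zero _).hasDerivAt
  have h5 := h4.comp_hasFDerivAt x h1
  have h6 : fderiv ℝ (ramp h δ m) x = _ := h5.fderiv
  rw [h6]
  simp
  ring

theorem fderiv_cutoff [DecidableEq (Pt d)] (S : Finset (Pt d)) (h : Pt d → ℝ) (δ : ℝ)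
    (x v : Pt d) :
    fderiv ℝ (cutoff S h δ) x v = -(δ⁻¹ * ∑ n ∈ S, inner ℝ n v *
      (deriv Real.smoothTransition ((h n - inner ℝ n x) / δ - 1) *
        ∏ m ∈ S.erase n, ramp h δ m x)) := by
  have h1 : HasFDerivAt (cutoff S h δ)
      (∑ n ∈ S, (∏ m ∈ S.erase n, ramp h δ m x) • fderiv ℝ (ramp h δ n) x) x :=
    (HasFDerivAt.finsetProd (u := S) (g := ramp h δ) fun n _ =>
      ((contDiff_ramp h δ n).differentiable (by simp) x).hasFDerivAt).congr_of_eventuallyEq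
      (Eventually.of_forall fun y => by simp [cutoff])
  rw [h1.fderiv, sum_apply, Finset.mul_sum, ← Finset.sum_neg_distrib]
  refine Finset.sum_congr rfl fun n _ => ?_
  rw [smul_apply, fderiv_ramp, smul_eq_mul]
  ring

theorem sum_mul_fderiv_single (f : Pt d → ℝ) (x v : Pt d) :
    ∑ i, v i * fderiv ℝ f x (EuclideanSpace.single i 1) = fderiv ℝ f x v := by
  conv_rhs => rw [← (EuclideanSpace.basisFun (Fin d) ℝ).sum_repr v]
  rw [map_sum]
  simp

/-- The divergence theorem on a convex polytope for the product of a smooth function and a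
continuous field whose weak derivatives are bounded: test the weak derivatives with the product of
the function and the cutoff, and let the boundary layer shrink. -/
theorem integral_divergence_polytope {Ω K : Set (Pt d)} {S : Finset (Pt d)} {h : Pt d → ℝ}
    (hK : IsCompact K) (hconv : Convex ℝ K) (hKΩ : interior K ⊆ Ω) (hS : ∀ m ∈ S, ‖m‖ = 1)
    (hKS : K = {x | ∀ m ∈ S, inner ℝ m x ≤ h m}) {x₀ : Pt d} (hx₀ : ∀ m ∈ S, inner ℝ m x₀ < h m)
    {b : Pt d → Pt d} (hb : ContinuousOn b K) {Db : Fin d → Fin d → Pt d → ℝ}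
    (hDb : ∀ i, IsW1Inf Ω (fun x => b x i) (Db i)) {w : Pt d → ℝ} (hw : ContDiff ℝ ∞ w) :
    ∫ x in K, (inner ℝ (b x) (∇ w x) + (∑ i, Db i i x) * w x)
      = ∑ n ∈ S, ∫ x in {x ∈ K | inner ℝ n x = h n}, inner ℝ n (b x) * w x ∂μHE[d - 1] := by
  classical
  simp_rw [inner_gradient_right]
  have hKm : MeasurableSet K := hK.isClosed.measurableSet
  have hwc : Continuous (fun x => fderiv ℝ w x) := hw.continuous_fderiv (by simp)
  have hDi : ∀ i, IntegrableOn (fun x => Db i i x) K := fun i => by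
    have : IsFiniteMeasure (volume.restrict K) := isFiniteMeasure_restrict.2 hK.measure_lt_top.ne
    exact (memLp_restrict_of_interior_subset hconv hKΩ ((hDb i).memLp_deriv i)).integrable le_top
  have hDw : ∀ {g : Pt d → ℝ}, Continuous g → ∀ i, IntegrableOn (fun x => Db i i x * g x) K :=
    fun hg i => (hDi i).mul_continuousOn hg.continuousOn hK
  have hcw : ContinuousOn (fun x => fderiv ℝ w x (b x)) K := hwc.continuousOn.clm_apply hb
  have hgint : IntegrableOn (fun x => fderiv ℝ w x (b x) + (∑ i, Db i i x) * w x) K := by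
    refine (hcw.integrableOn_compact hK).add ?_
    simp_rw [Finset.sum_mul]
    exact integrable_finsetSum _ fun i _ => hDw hw.continuous i
  -- the identity before passing to the limit
  have hid : ∀ δ : ℝ, 0 < δ →
      ∫ x in K, cutoff S h δ x * (fderiv ℝ w x (b x) + (∑ i, Db i i x) * w x)
        = ∑ n ∈ S, δ⁻¹ * ∫ x in K, (inner ℝ n (b x) * w x) *
          (deriv Real.smoothTransition ((h n - inner ℝ n x) / δ - 1) *
            ∏ m ∈ S.erase n, ramp h δ m x) := by
    intro δ hδ
    have hχ := contDiff_cutoff S h δ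
    have hχc : Continuous (fun x => fderiv ℝ (cutoff S h δ) x) := hχ.continuous_fderiv (by simp)
    let Kδ : Set (Pt d) := {x | ∀ m ∈ S, δ ≤ h m - inner ℝ m x}
    have hKδ : IsClosed Kδ := by
      have : Kδ = ⋂ m ∈ S, {x | δ ≤ h m - inner ℝ m x} := by ext x; simp [Kδ]
      rw [this]
      exact isClosed_biInter fun m _ => isClosed_le continuous_const (by fun_prop)
    have hKδK : Kδ ⊆ K := fun x hx => by
      rw [hKS]; intro m hm; linarith [hx m hm]
    have hKδint : Kδ ⊆ interior K := by
      have hopen : IsOpen {x : Pt d | ∀ m ∈ S, inner ℝ m x < h m} := by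
        have : {x : Pt d | ∀ m ∈ S, inner ℝ m x < h m} = ⋂ m ∈ S, {x | inner ℝ m x < h m} := by
          ext x; simp
        rw [this]
        exact isOpen_biInter_finset fun m _ => isOpen_lt (by fun_prop) continuous_const
      refine fun x hx => interior_maximal ?_ hopen (fun m hm => by linarith [hx m hm])
      intro y hy; rw [hKS]; exact fun m hm => (hy m hm).le
    let φ : Pt d → ℝ := fun x => cutoff S h δ x * w x
    have hφ : ContDiff ℝ ∞ φ := hχ.mul hw
    have hφ0 : ∀ x, x ∉ Kδ → φ x = 0 := by
      intro x hx
      simp only [Kδ, Set.mem_ofPred_eq, not_forall, not_le] at hx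
      obtain ⟨m, hm, hlt⟩ := hx
      simp only [φ]
      rw [cutoff_eq_zero hδ hm hlt.le, zero_mul]
    have htsupp : tsupport φ ⊆ Kδ := by
      refine closure_minimal (fun x hx => ?_) hKδ
      by_contra hxn
      exact hx (hφ0 x hxn)
    have hcomp : HasCompactSupport φ :=
      HasCompactSupport.intro (hK.of_isClosed_subset hKδ hKδK) fun x hx => hφ0 x hx
    have hfφ0 : ∀ x, x ∉ Kδ → fderiv ℝ φ x = 0 := fun x hx => by
      by_contra hne
      exact hx (htsupp (support_fderiv_subset ℝ hne))
    have hset : ∀ f : Pt d → ℝ, (∀ x, x ∉ Kδ → f x = 0) → ∫ x in Ω, f x = ∫ x in K, f x := by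
      intro f hf
      rw [setIntegral_eq_integral_of_forall_compl_eq_zero fun x hx => hf x fun h' =>
          hx (hKΩ (hKδint h')),
        setIntegral_eq_integral_of_forall_compl_eq_zero fun x hx => hf x fun h' => hx (hKδK h')]
    have hweak : ∀ i, ∫ x in K, b x i * fderiv ℝ φ x (EuclideanSpace.single i 1)
        = -∫ x in K, Db i i x * φ x := by
      intro i
      have h1 := (hDb i).weak_deriv i φ hφ hcomp (htsupp.trans (hKδint.trans hKΩ))
      rwa [hset _ fun x hx => by rw [hfφ0 x hx]; simp,
        hset _ fun x hx => by rw [hφ0 x hx, mul_zero]]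
        at h1
    have hbi : ∀ i, ContinuousOn (fun x => b x i) K := fun i =>
      (EuclideanSpace.proj (𝕜 := ℝ) i).continuous.comp_continuousOn hb
    have hφc : Continuous (fun x => fderiv ℝ φ x) := hφ.continuous_fderiv (by simp)
    have hsum : ∫ x in K, fderiv ℝ φ x (b x) = -∫ x in K, (∑ i, Db i i x) * φ x := by
      simp_rw [Finset.sum_mul, ← sum_mul_fderiv_single φ _ (b _)]
      have hi : ∀ i, IntegrableOn
          (fun x => b x i * fderiv ℝ φ x (EuclideanSpace.single i 1)) K := fun i =>
        ((hbi i).mul (hφc.clm_apply continuous_const).continuousOn).integrableOn_compact hK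
      rw [integral_finsetSum _ fun i _ => hi i,
        integral_finsetSum _ fun i _ => hDw hφ.continuous i, ← Finset.sum_neg_distrib]
      exact Finset.sum_congr rfl fun i _ => hweak i
    have hφd : ∀ x, fderiv ℝ φ x (b x)
        = cutoff S h δ x * fderiv ℝ w x (b x) + w x * fderiv ℝ (cutoff S h δ) x (b x) := by
      intro x
      have : fderiv ℝ φ x = _ := fderiv_fun_mul (hχ.differentiable (by simp) x)
        (hw.differentiable (by simp) x)
      rw [this]; simp
    have hI1 : IntegrableOn (fun x => cutoff S h δ x * fderiv ℝ w x (b x)) K :=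
      (hχ.continuous.continuousOn.mul hcw).integrableOn_compact hK
    have hI2 : IntegrableOn (fun x => w x * fderiv ℝ (cutoff S h δ) x (b x)) K :=
      (hw.continuous.continuousOn.mul (hχc.continuousOn.clm_apply hb)).integrableOn_compact hK
    have hI3 : IntegrableOn (fun x => (∑ i, Db i i x) * φ x) K := by
      simp_rw [Finset.sum_mul]
      exact integrable_finsetSum _ fun i _ => hDw hφ.continuous i
    have hL : ∫ x in K, cutoff S h δ x * (fderiv ℝ w x (b x) + (∑ i, Db i i x) * w x)
        = (∫ x in K, cutoff S h δ x * fderiv ℝ w x (b x)) + ∫ x in K, (∑ i, Db i i x) * φ x := by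
      rw [← integral_add hI1 hI3]
      refine integral_congr_ae (Eventually.of_forall fun x => ?_)
      simp only [φ]; ring
    simp_rw [hφd] at hsum
    rw [integral_add hI1 hI2] at hsum
    have hR : ∫ x in K, w x * fderiv ℝ (cutoff S h δ) x (b x)
        = -∑ n ∈ S, δ⁻¹ * ∫ x in K, (inner ℝ n (b x) * w x) *
          (deriv Real.smoothTransition ((h n - inner ℝ n x) / δ - 1) *
            ∏ m ∈ S.erase n, ramp h δ m x) := by
      simp_rw [← integral_const_mul]
      rw [← integral_finsetSum, ← integral_neg]
      · refine integral_congr_ae (Eventually.of_forall fun x => ?_)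
        simp only
        rw [fderiv_cutoff, Finset.mul_sum, ← Finset.sum_neg_distrib, ← Finset.sum_neg_distrib,
          Finset.mul_sum]
        refine Finset.sum_congr rfl fun n _ => ?_
        ring
      · intro n _
        refine ContinuousOn.integrableOn_compact hK ?_
        refine continuousOn_const.mul (((continuousOn_const.inner hb).mul
          hw.continuous.continuousOn).mul (Continuous.continuousOn ?_))
        exact (continuous_deriv_smoothTransition.comp (by fun_prop)).mul
          (continuous_finsetProd _ fun m _ => (contDiff_ramp h δ m).continuous)
    rw [hL]
    linarith
  have hlim1 : Tendsto (fun δ : ℝ => ∫ x in K, cutoff S h δ x *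
      (fderiv ℝ w x (b x) + (∑ i, Db i i x) * w x)) (𝓝[>] 0)
      (𝓝 (∫ x in K, (fderiv ℝ w x (b x) + (∑ i, Db i i x) * w x))) := by
    refine tendsto_integral_filter_of_dominated_convergence
      (fun x => ‖fderiv ℝ w x (b x) + (∑ i, Db i i x) * w x‖) ?_ ?_ hgint.norm ?_
    · exact Eventually.of_forall fun δ =>
        (contDiff_cutoff S h δ).continuous.aestronglyMeasurable.mul hgint.aestronglyMeasurable
    · refine Eventually.of_forall fun δ => Eventually.of_forall fun x => ?_
      rw [norm_mul]
      refine mul_le_of_le_one_left (norm_nonneg _) ?_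
      rw [cutoff, Real.norm_of_nonneg (Finset.prod_nonneg fun m _ => ramp_nonneg _ _ _ _)]
      exact Finset.prod_le_one (fun m _ => ramp_nonneg _ _ _ _) fun m _ => ramp_le_one _ _ _ _
    · have h1 : (interior K : Set (Pt d)) =ᵐ[volume] K :=
        interior_ae_eq_of_null_frontier (hconv.addHaar_frontier volume)
      rw [← Measure.restrict_congr_set h1]
      filter_upwards [ae_restrict_mem isOpen_interior.measurableSet] with x hx
      have hlt : ∀ m ∈ S, inner ℝ m x < h m := fun m hm =>
        inner_lt_of_mem_interior (hS m hm) (fun y hy => by rw [hKS] at hy; exact hy m hm) hx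
      have hev : ∀ᶠ δ : ℝ in 𝓝[>] 0, ∀ m ∈ S, 2 * δ ≤ h m - inner ℝ m x := by
        rw [Filter.eventually_all_finset]
        intro m hm
        have : ∀ᶠ δ : ℝ in 𝓝 0, δ < (h m - inner ℝ m x) / 2 :=
          gt_mem_nhds (by linarith [hlt m hm])
        filter_upwards [nhdsWithin_le_nhds this] with δ hδ using by linarith
      refine tendsto_const_nhds.congr' ?_
      filter_upwards [hev, self_mem_nhdsWithin] with δ h2 h3
      rw [cutoff, Finset.prod_eq_one fun m hm => ramp_eq_one h3 (h2 m hm), one_mul]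
  have hlim2 := tendsto_finsetSum S fun n hn => tendsto_boundary_layer hK hS hKS hx₀ hn
    (G := fun x => inner ℝ n (b x) * w x)
    ((continuousOn_const.inner hb).mul hw.continuous.continuousOn)
  refine tendsto_nhds_unique hlim1 (hlim2.congr' ?_)
  filter_upwards [self_mem_nhdsWithin] with δ hδ using (hid δ hδ).symm

end Divergence

/-! ### Geometry of the mesh -/

namespace Mesh

open Filter Topology

variable {d : ℕ} {ι κ : Type*}

theorem cell_isCompact (M : Mesh d ι κ) (i : ι) : IsCompact (M.cell i) := by
  obtain ⟨s, hs⟩ := M.cell_polytope i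
  rw [hs]
  exact s.finite_toSet.isCompact_convexHull ℝ

theorem cell_convex (M : Mesh d ι κ) (i : ι) : Convex ℝ (M.cell i) := by
  obtain ⟨s, hs⟩ := M.cell_polytope i
  rw [hs]
  exact convex_convexHull ℝ _

theorem face_nonempty (M : Mesh d ι κ) (k : κ) : (M.face k).Nonempty :=
  nonempty_of_measure_ne_zero (M.face_pos k).ne'

open Classical in
/-- The unit normal on the face `k` that points out of the adjacent element `i`. -/
noncomputable def outNormal (M : Mesh d ι κ) (k : κ) (i : ι) : Pt d :=
  if M.plus k = i then M.normal k else -M.normal k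

theorem outNormal_plus (M : Mesh d ι κ) (k : κ) : M.outNormal k (M.plus k) = M.normal k :=
  if_pos rfl

theorem norm_outNormal (M : Mesh d ι κ) (k : κ) (i : ι) : ‖M.outNormal k i‖ = 1 := by
  rw [outNormal]
  split_ifs
  · exact M.norm_normal k
  · rw [norm_neg]; exact M.norm_normal k

theorem face_subset_supportFace (M : Mesh d ι κ) {k : κ} {i : ι} (hki : M.Adj k i) :
    M.face k ⊆ supportFace (M.cell i) (M.outNormal k i) := by
  by_cases h : M.plus k = i
  · rw [outNormal, if_pos h, ← h]; exact M.face_plus k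
  · rw [outNormal, if_neg h]; exact M.face_minus k i (hki.resolve_left h)

theorem face_subset_cell (M : Mesh d ι κ) {k : κ} {i : ι} (hki : M.Adj k i) :
    M.face k ⊆ M.cell i := fun _ hx => (M.face_subset_supportFace hki hx).1

theorem adj_plus (M : Mesh d ι κ) (k : κ) : M.Adj k (M.plus k) := Or.inl rfl

/-- A face separates two different elements: an element on both sides of a face would lie in the
hyperplane of the face. -/
theorem plus_ne_of_minus (M : Mesh d ι κ) {k : κ} {j : ι} (hj : M.minus k = some j) :
    M.plus k ≠ j := by
  rintro rfl
  obtain ⟨x, hx⟩ := M.face_nonempty k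
  obtain ⟨y, hy⟩ := M.cell_interior (M.plus k)
  have h1 := inner_lt_of_mem_interior (M.norm_normal k) (M.face_plus k hx).2 hy
  have h2 := (M.face_minus k _ hj hx).2 y (interior_subset hy)
  rw [inner_neg_left, inner_neg_left] at h2
  linarith

theorem outNormal_minus (M : Mesh d ι κ) {k : κ} {j : ι} (hj : M.minus k = some j) :
    M.outNormal k j = -M.normal k := if_neg (M.plus_ne_of_minus hj)

theorem face_isCompact (M : Mesh d ι κ) (k : κ) : IsCompact (M.face k) :=
  (M.cell_isCompact (M.plus k)).of_isClosed_subset (M.face_closed k)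
    (M.face_subset_cell (M.adj_plus k))

theorem face_measure_lt_top (M : Mesh d ι κ) (k : κ) :
    (μHE[d - 1] : Measure (Pt d)) (M.face k) < ⊤ := by
  obtain ⟨x, hx⟩ := M.face_nonempty k
  refine hausdorff_hyperplane_lt_top (M.norm_normal k) (inner ℝ (M.normal k) x)
    (M.face_isCompact k).isBounded fun y hy => ?_
  have h1 := M.face_plus k hx
  have h2 := M.face_plus k hy
  exact le_antisymm (h1.2 y h2.1) (h2.2 x h1.1)

theorem continuousOn_integrableOn_face (M : Mesh d ι κ) (k : κ) {f : Pt d → ℝ}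
    (hf : ContinuousOn f (M.face k)) : IntegrableOn f (M.face k) (μHE[d - 1]) := by
  obtain ⟨C, hC⟩ := (M.face_isCompact k).exists_bound_of_continuousOn hf
  exact IntegrableOn.of_bound (M.face_measure_lt_top k)
    (hf.aestronglyMeasurable (M.face_closed k).measurableSet) C
    ((ae_restrict_mem (M.face_closed k).measurableSet).mono hC)

/-- The face `k` only serves to exclude dimension zero, where there are no unit vectors. -/
theorem cellSize_pos (M : Mesh d ι κ) (k : κ) (i : ι) : 0 < M.cellSize i := by
  obtain ⟨x, hx⟩ := M.cell_interior i
  obtain ⟨r, hr, hball⟩ := Metric.isOpen_iff.1 isOpen_interior x hx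
  have h1 : x + (r / 2) • M.normal k ∈ M.cell i := by
    refine interior_subset (hball ?_)
    rw [Metric.mem_ball, dist_self_add_left, norm_smul, M.norm_normal,
      Real.norm_of_nonneg (by positivity)]
    linarith
  have h2 := Metric.dist_le_diam_of_mem (M.cell_isCompact i).isBounded h1 (interior_subset hx)
  rw [dist_self_add_left, norm_smul, M.norm_normal, Real.norm_of_nonneg (by positivity)] at h2
  exact lt_of_lt_of_le (by positivity) h2

theorem faceSize_pos (M : Mesh d ι κ) (k : κ) : 0 < M.faceSize k := by
  rw [faceSize]
  split_ifs with hd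
  · split
    · exact lt_min (M.cellSize_pos k _) (M.cellSize_pos k _)
    · exact M.cellSize_pos k _
  · refine Metric.diam_pos (Set.not_subsingleton_iff.1 fun hsub => ?_)
      (M.face_isCompact k).isBounded
    -- in dimension at least two, points have no surface measure
    obtain ⟨x, hx⟩ := M.face_nonempty k
    have hn0 : M.normal k ≠ 0 := by
      intro h0; have := M.norm_normal k; rw [h0, norm_zero] at this; exact zero_ne_one this
    have hd2 : 0 < d - 1 := by
      have : d ≠ 0 := by
        rintro rfl
        exact hn0 (Subsingleton.elim _ _)
      omega
    have hfr : 0 < Module.finrank ℝ (ℝ ∙ M.normal k)ᗮ := by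
      rw [finrank_orthogonal_span_unit (M.norm_normal k)]; exact hd2
    have : Nontrivial (ℝ ∙ M.normal k)ᗮ := Module.finrank_pos_iff.1 hfr
    have h1 : (μHE[d - 1] : Measure (Pt d)) {x} = 0 := by
      have h2 : (μHE[d - 1] : Measure (Pt d)) {x} = (μHE[d - 1] : Measure (Pt d)).restrict
          {y | inner ℝ (M.normal k) y = inner ℝ (M.normal k) x} {x} :=
        (Measure.restrict_eq_self _ (by simp)).symm
      rw [h2, ← map_hyperplaneMap_volume (M.norm_normal k),
        (measurableEmbedding_hyperplaneMap _ _).map_apply]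
      exact (Set.subsingleton_singleton.preimage
        (isometry_hyperplaneMap _ _).injective).measure_zero volume
    have h3 := M.face_pos k
    rw [hsub.eq_singleton_of_mem hx, h1] at h3
    exact lt_irrefl _ h3

/-- The support function of the element `i`. -/
noncomputable def height (M : Mesh d ι κ) (i : ι) (n : Pt d) : ℝ :=
  sSup ((fun x => inner ℝ n x) '' M.cell i)

theorem inner_le_height (M : Mesh d ι κ) (i : ι) (n : Pt d) {x : Pt d} (hx : x ∈ M.cell i) :
    inner ℝ n x ≤ M.height i n :=
  le_csSup ((M.cell_isCompact i).image
    (by fun_prop : Continuous fun x : Pt d => inner ℝ n x)).bddAbove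
    (Set.mem_image_of_mem _ hx)

theorem mem_supportFace_iff (M : Mesh d ι κ) (i : ι) (n : Pt d) {x : Pt d} :
    x ∈ supportFace (M.cell i) n ↔ x ∈ M.cell i ∧ inner ℝ n x = M.height i n := by
  refine ⟨fun h => ⟨h.1, le_antisymm (M.inner_le_height i n h.1) ?_⟩,
    fun h => ⟨h.1, fun y hy => ?_⟩⟩
  · refine csSup_le ⟨_, Set.mem_image_of_mem _ h.1⟩ ?_
    rintro _ ⟨y, hy, rfl⟩
    exact h.2 y hy
  · rw [h.2]; exact M.inner_le_height i n hy

theorem interior_cell_subset_domain (M : Mesh d ι κ) (i : ι) : interior (M.cell i) ⊆ M.domain :=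
  interior_mono (Set.subset_iUnion M.cell i)

theorem cell_subset_closure_domain (M : Mesh d ι κ) (i : ι) : M.cell i ⊆ closure M.domain := by
  rw [← ((M.cell_isCompact i).isClosed.closure_eq),
    ← (M.cell_convex i).closure_interior_eq_closure_of_nonempty_interior (M.cell_interior i)]
  exact closure_mono (interior_mono (Set.subset_iUnion M.cell i))

section Facets

variable [Fintype κ]

open Classical in
/-- The faces of the element `i`. -/
noncomputable def adjFaces (M : Mesh d ι κ) (i : ι) : Finset κ :=
  Finset.univ.filter fun k => M.Adj k i

theorem mem_adjFaces (M : Mesh d ι κ) {k : κ} {i : ι} : k ∈ M.adjFaces i ↔ M.Adj k i := by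
  simp [adjFaces]

open Classical in
/-- The outward unit normals of the element `i`. Several faces may have the same normal. -/
noncomputable def outNormals (M : Mesh d ι κ) (i : ι) : Finset (Pt d) :=
  (M.adjFaces i).image fun k => M.outNormal k i

theorem norm_of_mem_outNormals (M : Mesh d ι κ) {i : ι} {n : Pt d} (hn : n ∈ M.outNormals i) :
    ‖n‖ = 1 := by
  classical
  obtain ⟨k, -, rfl⟩ := Finset.mem_image.1 hn
  exact M.norm_outNormal k i

theorem inner_lt_height (M : Mesh d ι κ) {i : ι} {n : Pt d} (hn : n ∈ M.outNormals i) {x : Pt d}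
    (hx : x ∈ interior (M.cell i)) : inner ℝ n x < M.height i n :=
  inner_lt_of_mem_interior (M.norm_of_mem_outNormals hn) (fun _ hy => M.inner_le_height i n hy) hx

/-- Since the faces cover the boundary, an element is the intersection of the half-spaces of its
outward normals. -/
theorem cell_eq_halfSpaces (M : Mesh d ι κ) (i : ι) :
    M.cell i = {x | ∀ n ∈ M.outNormals i, inner ℝ n x ≤ M.height i n} := by
  classical
  refine Set.Subset.antisymm (fun x hx n _ => M.inner_le_height i n hx) fun x hx => ?_
  by_contra hxK
  obtain ⟨x₀, hx₀⟩ := M.cell_interior i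
  -- the segment from an interior point to `x` leaves the element through some face
  let L : ℝ → Pt d := fun t => x₀ + t • (x - x₀)
  have hL : Continuous L := by fun_prop
  obtain ⟨t, ht, htf⟩ : ∃ t ∈ Set.Icc (0 : ℝ) 1, L t ∈ frontier (M.cell i) := by
    have hconn : IsPreconnected (L '' Set.Icc 0 1) := isPreconnected_Icc.image _ hL.continuousOn
    by_contra! hno
    have hcl := (M.cell_isCompact i).isClosed
    obtain ⟨y, -, hy, hy'⟩ := hconn (interior (M.cell i)) (M.cell i)ᶜ isOpen_interior
      hcl.isOpen_compl (by
        rintro _ ⟨t, ht, rfl⟩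
        by_contra h
        rw [Set.mem_union, not_or, Set.mem_compl_iff, not_not] at h
        exact hno t ht (by rw [hcl.frontier_eq]; exact ⟨h.2, h.1⟩))
      ⟨x₀, ⟨0, by simp, by simp [L]⟩, hx₀⟩
      ⟨x, ⟨1, by simp, by simp [L]⟩, hxK⟩
    exact hy' (interior_subset hy)
  obtain ⟨k, hk, hkf⟩ := M.face_cover i _ htf
  have hmem : M.outNormal k i ∈ M.outNormals i :=
    Finset.mem_image_of_mem _ (M.mem_adjFaces.2 hk)
  have h1 := ((M.mem_supportFace_iff i _).1 (M.face_subset_supportFace hk hkf)).2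
  have h2 := M.inner_lt_height hmem hx₀
  have h3 := hx _ hmem
  have ht1 : t < 1 := by
    refine lt_of_le_of_ne ht.2 ?_
    rintro rfl
    have : L 1 = x := by simp [L]
    rw [this] at htf
    exact hxK ((M.cell_isCompact i).isClosed.frontier_subset htf)
  simp only [L, inner_add_right, inner_smul_right, inner_sub_right] at h1
  nlinarith [ht.1]

/-- Up to null sets, a facet of an element is the disjoint union of the faces that have its normal:
a face with another normal meets the facet in an intersection of two hyperplanes. -/
theorem setIntegral_facet (M : Mesh d ι κ) (i : ι) {n : Pt d} (hn : n ∈ M.outNormals i)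
    {g : Pt d → ℝ} (hg : ContinuousOn g (M.cell i)) :
    ∫ x in {x ∈ M.cell i | inner ℝ n x = M.height i n}, g x ∂μHE[d - 1]
      = ∑ k ∈ M.adjFaces i with M.outNormal k i = n, ∫ x in M.face k, g x ∂μHE[d - 1] := by
  let T : Finset κ := {k ∈ M.adjFaces i | M.outNormal k i = n}
  have hT : ∀ k : T, M.Adj k i ∧ M.outNormal k i = n := fun k => by
    have := k.2
    simp only [T, Finset.mem_filter, mem_adjFaces] at this
    exact this
  have hn1 := M.norm_of_mem_outNormals hn
  obtain ⟨x₀, hx₀⟩ := M.cell_interior i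
  have hedge : ∀ m ∈ (M.outNormals i).erase n, (μHE[d - 1] : Measure (Pt d))
      ({x | inner ℝ m x = M.height i m} ∩ {x | inner ℝ n x = M.height i n}) = 0 := by
    intro m hm
    have hm' := Finset.mem_of_mem_erase hm
    have h1 : MeasurableSet {x : Pt d | inner ℝ m x = M.height i m} :=
      (isClosed_eq (by fun_prop) continuous_const).measurableSet
    rw [← Measure.restrict_apply h1, ← map_hyperplaneMap_volume hn1,
      (measurableEmbedding_hyperplaneMap _ _).map_apply]
    exact volume_hyperplane_inter hn1 (M.norm_of_mem_outNormals hm') (Finset.ne_of_mem_erase hm)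
      (M.inner_lt_height hn hx₀) (M.inner_lt_height hm' hx₀)
  have hsub : (⋃ k : T, M.face k) ⊆ {x ∈ M.cell i | inner ℝ n x = M.height i n} := by
    refine Set.iUnion_subset fun k x hx => ?_
    have := (M.mem_supportFace_iff i _).1 (M.face_subset_supportFace (hT k).1 hx)
    rw [(hT k).2] at this
    exact this
  have hdiff : {x ∈ M.cell i | inner ℝ n x = M.height i n} \ (⋃ k : T, M.face k)
      ⊆ ⋃ m ∈ (M.outNormals i).erase n,
        ({x | inner ℝ m x = M.height i m} ∩ {x | inner ℝ n x = M.height i n}) := by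
    rintro x ⟨⟨hxK, hxn⟩, hxU⟩
    have hfr : x ∈ frontier (M.cell i) := by
      rw [(M.cell_isCompact i).isClosed.frontier_eq]
      exact ⟨hxK, fun hint => (M.inner_lt_height hn hint).ne hxn⟩
    obtain ⟨k, hk, hkx⟩ := M.face_cover i x hfr
    have hmem : M.outNormal k i ∈ M.outNormals i := by
      rw [outNormals, Finset.mem_image]
      exact ⟨k, M.mem_adjFaces.2 hk, rfl⟩
    have hne : M.outNormal k i ≠ n := by
      intro h
      exact hxU (Set.mem_iUnion.2 ⟨⟨k, by simp [T, mem_adjFaces, h]; exact hk⟩, hkx⟩)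
    exact Set.mem_biUnion (Finset.mem_coe.2 (Finset.mem_erase.2 ⟨hne, hmem⟩))
      ⟨((M.mem_supportFace_iff i _).1 (M.face_subset_supportFace hk hkx)).2, hxn⟩
  have hae : {x ∈ M.cell i | inner ℝ n x = M.height i n} =ᵐ[μHE[d - 1]] ⋃ k : T, M.face k := by
    refine (ae_eq_set.2 ⟨measure_mono_null hdiff ?_, ?_⟩)
    · exact (measure_biUnion_null_iff (Finset.countable_toSet _)).2 hedge
    · rw [Set.sdiff_eq_empty.2 hsub, measure_empty]
  rw [setIntegral_congr_set hae, integral_iUnion_ae (s := fun k : T => M.face k)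
    (fun k => (M.face_closed k).measurableSet.nullMeasurableSet)
    (fun k l hkl => M.face_disjoint k l fun h => hkl (Subtype.ext h)) ?_, tsum_fintype,
    Finset.sum_coe_sort T (fun k => ∫ x in M.face k, g x ∂μHE[d - 1])]
  rw [integrableOn_finite_iUnion]
  exact fun k => M.continuousOn_integrableOn_face k (hg.mono (M.face_subset_cell (hT k).1))

/-- The divergence theorem on the element `i` for the product of the velocity field and a smooth
function. -/
theorem integral_divergence_cell (M : Mesh d ι κ) (D : Coefficients M.domain) (i : ι)
    {w : Pt d → ℝ}
    (hw : ContDiff ℝ ∞ w) :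
    ∫ x in M.cell i, (inner ℝ (D.b x) (∇ w x) + D.divb x * w x)
      = ∑ k ∈ M.adjFaces i,
        ∫ x in M.face k, inner ℝ (M.outNormal k i) (D.b x) * w x ∂μHE[d - 1] := by
  classical
  obtain ⟨x₀, hx₀⟩ := M.cell_interior i
  have hb : ContinuousOn D.b (M.cell i) := D.b_cont.mono (M.cell_subset_closure_domain i)
  refine (integral_divergence_polytope (M.cell_isCompact i) (M.cell_convex i)
    (M.interior_cell_subset_domain i) (fun m hm => M.norm_of_mem_outNormals hm)
    (M.cell_eq_halfSpaces i) (fun m hm => M.inner_lt_height hm hx₀) hb D.b_W1Inf hw).trans ?_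
  refine Finset.sum_image' _ fun k hk => ?_
  rw [M.setIntegral_facet i (g := fun x => inner ℝ (M.outNormal k i) (D.b x) * w x)
    (Finset.mem_image_of_mem _ hk) ((continuousOn_const.inner hb).mul hw.continuous.continuousOn)]
  refine Finset.sum_congr rfl fun l hl => ?_
  rw [(Finset.mem_filter.1 hl).2]

end Facets

section Sums

variable [Fintype ι] [Fintype κ]

/-- Summing over the faces of all elements means summing over both sides of all faces. -/
theorem sum_adjFaces (M : Mesh d ι κ) (f : κ → ι → ℝ) :
    ∑ i, ∑ k ∈ M.adjFaces i, f k i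
      = ∑ k, (f k (M.plus k) + (M.minus k).elim 0 fun j => f k j) := by
  classical
  simp only [adjFaces, Finset.sum_filter]
  rw [Finset.sum_comm]
  refine Finset.sum_congr rfl fun k _ => ?_
  have h1 : ∀ i, (if M.Adj k i then f k i else 0) = (if M.plus k = i then f k i else 0)
      + (if M.minus k = some i then f k i else 0) := by
    intro i
    by_cases h1 : M.plus k = i <;> by_cases h2 : M.minus k = some i
    · exact absurd h1 (M.plus_ne_of_minus h2)
    all_goals simp [Adj, h1, h2]
  rw [Finset.sum_congr rfl fun i _ => h1 i, Finset.sum_add_distrib]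
  congr 1
  · simp
  · cases h : M.minus k <;> simp

end Sums

end Mesh

/-! ### Polynomial spaces -/

section Polynomials

open Filter Topology

variable {d : ℕ}

theorem hasFDerivAt_eval (q : MvPolynomial (Fin d) ℝ) {f : Fin d → Pt d → ℝ}
    {f' : Fin d → Pt d →L[ℝ] ℝ} {x : Pt d} (hf : ∀ k, HasFDerivAt (f k) (f' k) x) :
    HasFDerivAt (fun y => MvPolynomial.eval (fun k => f k y) q)
      (∑ k, MvPolynomial.eval (fun k => f k x) (MvPolynomial.pderiv k q) • f' k) x := by
  induction q using MvPolynomial.induction_on with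
  | C a => simpa using hasFDerivAt_const a x
  | add p q hp hq =>
    simp only [map_add, add_smul, Finset.sum_add_distrib]
    exact hp.add hq
  | mul_X p i hp =>
    have h := hp.mul (hf i)
    simp only [map_mul, MvPolynomial.eval_X]
    refine h.congr_fderiv ?_
    simp only [Derivation.leibniz, MvPolynomial.pderiv_X, smul_eq_mul, map_add, map_mul,
      MvPolynomial.eval_X, add_smul, Finset.sum_add_distrib, Finset.smul_sum, smul_smul]
    congr 1
    rw [Finset.sum_eq_single i]
    · simp
    · intro k _ hk
      simp [Pi.single_eq_of_ne hk.symm]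
    · simp

theorem pderiv_mem_refSpace (p : ℕ) (kind : PolyKind) (k : Fin d) {q : MvPolynomial (Fin d) ℝ}
    (hq : q ∈ refSpace d p kind) : MvPolynomial.pderiv k q ∈ refSpace d p kind := by
  have key : ∀ s : Set (Fin d →₀ ℕ), (∀ m, m + Finsupp.single k 1 ∈ s → m ∈ s) →
      q ∈ MvPolynomial.restrictSupport ℝ s →
      MvPolynomial.pderiv k q ∈ MvPolynomial.restrictSupport ℝ s := by
    intro s hs hqs
    rw [MvPolynomial.mem_restrictSupport_iff] at hqs ⊢
    intro m hm
    refine hs m (hqs ?_)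
    rw [Finset.mem_coe, MvPolynomial.mem_support_iff] at hm ⊢
    rw [MvPolynomial.coeff_pderiv] at hm
    exact left_ne_zero_of_mul hm
  cases kind with
  | P =>
    refine key _ (fun m hm => ?_) hq
    simp only [Set.mem_ofPred_eq] at hm ⊢
    rw [Finsupp.sum_fintype _ _ (fun _ => rfl)] at hm ⊢
    refine le_trans (Finset.sum_le_sum fun i _ => ?_) hm
    simp
  | Q =>
    refine key _ (fun m hm i => ?_) hq
    have := hm i
    rw [Finsupp.add_apply] at this
    omega

theorem symm_coord_eq (T : Pt d ≃ᵃ[ℝ] Pt d) (j : Fin d) :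
    (fun x : Pt d => T.symm x j) = fun x => T.symm.linear x j + T.symm 0 j := by
  ext x
  have := T.symm.toAffineMap.map_vadd 0 x
  simp only [vadd_eq_add, add_zero] at this
  exact congrArg (fun y : Pt d => y j) this

theorem analyticOnNhd_evalFrame (T : Pt d ≃ᵃ[ℝ] Pt d) (q : MvPolynomial (Fin d) ℝ) :
    AnalyticOnNhd ℝ (evalFrame T q) Set.univ := by
  have h : AnalyticOnNhd ℝ
      (fun x : Pt d => MvPolynomial.aeval (fun j => T.symm x j) q) Set.univ := by
    refine AnalyticOnNhd.aeval_mvPolynomial (fun j => ?_) q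
    rw [symm_coord_eq T j]
    have h2 : AnalyticOnNhd ℝ (fun x : Pt d => T.symm.linear x j) Set.univ :=
      fun x _ => ((EuclideanSpace.proj (𝕜 := ℝ) j).comp
        (LinearMap.toContinuousLinearMap (T.symm.linear : Pt d →ₗ[ℝ] Pt d))).analyticAt x
    exact h2.add analyticOnNhd_const
  exact h

section LocalSpace

variable {p : ℕ} {kind : PolyKind} {T : Pt d ≃ᵃ[ℝ] Pt d} {v : Pt d → ℝ}

theorem analyticOnNhd_of_mem_localSpace (hv : v ∈ localSpace p kind T) :
    AnalyticOnNhd ℝ v Set.univ := by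
  obtain ⟨q, -, rfl⟩ := Submodule.mem_map.1 hv
  exact analyticOnNhd_evalFrame T q

theorem contDiff_of_mem_localSpace (hv : v ∈ localSpace p kind T) : ContDiff ℝ ∞ v :=
  (contDiffOn_univ.1 (analyticOnNhd_of_mem_localSpace hv).contDiffOn_of_completeSpace)

theorem continuous_of_mem_localSpace (hv : v ∈ localSpace p kind T) : Continuous v :=
  (contDiff_of_mem_localSpace hv).continuous

/-- The local spaces are closed under partial derivatives in the physical coordinates. -/
theorem fderiv_mem_localSpace (hv : v ∈ localSpace p kind T) (e : Pt d) :
    (fun x => fderiv ℝ v x e) ∈ localSpace p kind T := by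
  obtain ⟨q, hq, rfl⟩ := Submodule.mem_map.1 hv
  have hd : ∀ (k : Fin d) (x : Pt d), HasFDerivAt (fun x : Pt d => T.symm x k)
      ((EuclideanSpace.proj (𝕜 := ℝ) k).comp
        (LinearMap.toContinuousLinearMap (T.symm.linear : Pt d →ₗ[ℝ] Pt d))) x := by
    intro k x
    rw [symm_coord_eq T k]
    exact (((EuclideanSpace.proj (𝕜 := ℝ) k).comp (LinearMap.toContinuousLinearMap
      (T.symm.linear : Pt d →ₗ[ℝ] Pt d))).hasFDerivAt).add_const _
  have h2 : (fun x => fderiv ℝ (evalFrame T q) x e)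
      = evalFrame T (∑ k, (T.symm.linear e) k • MvPolynomial.pderiv k q) := by
    ext x
    have h3 : fderiv ℝ (evalFrame T q) x = _ := (hasFDerivAt_eval q fun k => hd k x).fderiv
    rw [h3]
    simp [evalFrame, mul_comm]
  rw [h2]
  exact Submodule.mem_map_of_mem
    (Submodule.sum_mem _ fun k _ => Submodule.smul_mem _ _ (pderiv_mem_refSpace p kind k hq))

instance finiteDimensional_localSpace : FiniteDimensional ℝ (localSpace p kind T) := by
  have : FiniteDimensional ℝ (refSpace d p kind) := by
    cases kind with
    | P => exact inferInstanceAs (Module.Finite ℝ (MvPolynomial.restrictTotalDegree (Fin d) ℝ p))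
    | Q => exact inferInstanceAs (Module.Finite ℝ (MvPolynomial.restrictDegree (Fin d) ℝ p))
  exact inferInstanceAs (FiniteDimensional ℝ ((refSpace d p kind).map (evalFrame T)))

/-- A polynomial that vanishes almost everywhere on a set with interior points is zero. -/
theorem eq_zero_of_setIntegral_sq_eq_zero (hv : v ∈ localSpace p kind T) {K : Set (Pt d)}
    (hK : IsCompact K) (hKi : (interior K).Nonempty) (h : ∫ x in K, v x ^ 2 = 0) : v = 0 := by
  have hc := continuous_of_mem_localSpace hv
  have hint : IntegrableOn (fun x => v x ^ 2) K := (hc.pow 2).continuousOn.integrableOn_compact hK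
  have h1 : (fun x => v x ^ 2) =ᵐ[volume.restrict K] 0 :=
    (setIntegral_eq_zero_iff_of_nonneg_ae (Eventually.of_forall fun x => sq_nonneg _) hint).1 h
  have h2 : (fun x => v x ^ 2) =ᵐ[volume.restrict (interior K)] 0 :=
    ae_restrict_of_ae_restrict_of_subset interior_subset h1
  have h3 : Set.EqOn (fun x => v x ^ 2) 0 (interior K) :=
    Measure.eqOn_open_of_ae_eq h2 isOpen_interior (hc.pow 2).continuousOn continuousOn_const
  obtain ⟨x, hx⟩ := hKi
  refine (analyticOnNhd_of_mem_localSpace hv).eq_of_eventuallyEq (z₀ := x) analyticOnNhd_const ?_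
  filter_upwards [isOpen_interior.mem_nhds hx] with y hy
  exact pow_eq_zero_iff two_ne_zero |>.1 (h3 hy)

end LocalSpace

end Polynomials

/-! ### Bilinear forms -/

section Forms

variable {V X : Type*} [AddCommGroup V] [Module ℝ V]

theorem isLinearMap_sum {α : Type*} (s : Finset α) {f : α → V → ℝ}
    (hf : ∀ a ∈ s, IsLinearMap ℝ (f a)) : IsLinearMap ℝ fun v => ∑ a ∈ s, f a v := by
  refine ⟨fun v w => ?_, fun c v => ?_⟩
  · rw [← Finset.sum_add_distrib]; exact Finset.sum_congr rfl fun a ha => (hf a ha).map_add v w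
  · rw [Finset.smul_sum]; exact Finset.sum_congr rfl fun a ha => (hf a ha).map_smul c v

theorem isLinearMap_add {f g : V → ℝ} (hf : IsLinearMap ℝ f) (hg : IsLinearMap ℝ g) :
    IsLinearMap ℝ fun v => f v + g v :=
  (IsLinearMap.mk' f hf + IsLinearMap.mk' g hg).isLinear

theorem isLinearMap_const_mul {f : V → ℝ} (c : ℝ) (hf : IsLinearMap ℝ f) :
    IsLinearMap ℝ fun v => c * f v :=
  (c • IsLinearMap.mk' f hf).isLinear

theorem isLinearMap_integral [MeasurableSpace X] {μ : Measure X} {f : V → X → ℝ}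
    (hf : ∀ x, IsLinearMap ℝ fun v => f v x) (hint : ∀ v, Integrable (f v) μ) :
    IsLinearMap ℝ fun v => ∫ x, f v x ∂μ := by
  refine ⟨fun v w => ?_, fun c v => ?_⟩
  · rw [← integral_add (hint v) (hint w)]
    simp_rw [fun x => (hf x).map_add v w]
  · rw [smul_eq_mul, ← integral_const_mul]
    simp_rw [fun x => (hf x).map_smul c v, smul_eq_mul]

theorem _root_.IsBilinearMap.of_isLinearMap {f : V → V → ℝ}
    (hl : ∀ w, IsLinearMap ℝ fun v => f v w) (hr : ∀ v, IsLinearMap ℝ fun w => f v w) :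
    IsBilinearMap ℝ f where
  add_left v v' w := (hl w).map_add v v'
  smul_left c v w := (hl w).map_smul c v
  add_right v w w' := (hr v).map_add w w'
  smul_right c v w := (hr v).map_smul c w

theorem _root_.IsBilinearMap.left {f : V → V → ℝ} (hf : IsBilinearMap ℝ f) (w : V) :
    IsLinearMap ℝ fun v => f v w :=
  ⟨fun v v' => hf.add_left v v' w, fun c v => hf.smul_left c v w⟩

theorem _root_.IsBilinearMap.right {f : V → V → ℝ} (hf : IsBilinearMap ℝ f) (v : V) :
    IsLinearMap ℝ fun w => f v w :=
  ⟨fun w w' => hf.add_right v w w', fun c w => hf.smul_right c v w⟩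

theorem _root_.IsBilinearMap.add {f g : V → V → ℝ} (hf : IsBilinearMap ℝ f)
    (hg : IsBilinearMap ℝ g) :
    IsBilinearMap ℝ fun v w => f v w + g v w :=
  .of_isLinearMap (fun w => isLinearMap_add (hf.left w) (hg.left w))
    (fun v => isLinearMap_add (hf.right v) (hg.right v))

theorem _root_.IsBilinearMap.const_mul {f : V → V → ℝ} (c : ℝ) (hf : IsBilinearMap ℝ f) :
    IsBilinearMap ℝ fun v w => c * f v w :=
  .of_isLinearMap (fun w => isLinearMap_const_mul c (hf.left w))
    (fun v => isLinearMap_const_mul c (hf.right v))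

theorem _root_.IsBilinearMap.sub {f g : V → V → ℝ} (hf : IsBilinearMap ℝ f)
    (hg : IsBilinearMap ℝ g) :
    IsBilinearMap ℝ fun v w => f v w - g v w := by
  simpa [sub_eq_add_neg] using hf.add (hg.const_mul (-1))

theorem _root_.IsBilinearMap.flip {f : V → V → ℝ} (hf : IsBilinearMap ℝ f) :
    IsBilinearMap ℝ fun v w => f w v :=
  .of_isLinearMap hf.right hf.left

theorem _root_.IsBilinearMap.sum {α : Type*} (s : Finset α) {f : α → V → V → ℝ}
    (hf : ∀ a ∈ s, IsBilinearMap ℝ (f a)) : IsBilinearMap ℝ fun v w => ∑ a ∈ s, f a v w :=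
  .of_isLinearMap (fun w => isLinearMap_sum s fun a ha => (hf a ha).left w)
    (fun v => isLinearMap_sum s fun a ha => (hf a ha).right v)

theorem _root_.IsBilinearMap.integral [MeasurableSpace X] {μ : Measure X} {f : V → V → X → ℝ}
    (hf : ∀ x, IsBilinearMap ℝ fun v w => f v w x) (hint : ∀ v w, Integrable (f v w) μ) :
    IsBilinearMap ℝ fun v w => ∫ x, f v w x ∂μ :=
  .of_isLinearMap (fun w => isLinearMap_integral (fun x => (hf x).left w) fun v => hint v w)
    (fun v => isLinearMap_integral (fun x => (hf x).right v) fun w => hint v w)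

theorem isBilin_inner {E : Type*} [NormedAddCommGroup E] [InnerProductSpace ℝ E] {f g : V → E}
    (hf : IsLinearMap ℝ f) (hg : IsLinearMap ℝ g) :
    IsBilinearMap ℝ fun v w => inner ℝ (f v) (g w) := by
  refine ⟨fun v v' w => ?_, fun c v w => ?_, fun v w w' => ?_, fun c v w => ?_⟩
  · rw [hf.map_add, inner_add_left]
  · rw [hf.map_smul, inner_smul_left, smul_eq_mul]; simp
  · rw [hg.map_add, inner_add_right]
  · rw [hg.map_smul, inner_smul_right, smul_eq_mul]

theorem isBilin_mul {f g : V → ℝ} (hf : IsLinearMap ℝ f) (hg : IsLinearMap ℝ g) :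
    IsBilinearMap ℝ fun v w => f v * g w := by
  simpa [mul_comm] using isBilin_inner hf hg

/-- The quadratic form of a bilinear form is continuous in finite dimensions. -/
theorem _root_.IsBilinearMap.continuous_diag {E : Type*} [NormedAddCommGroup E] [NormedSpace ℝ E]
    [FiniteDimensional ℝ E] {f : E → E → ℝ} (hf : IsBilinearMap ℝ f) : Continuous fun v => f v v :=
  hf.toContinuousBilinearMap.continuous.clm_apply continuous_id

theorem _root_.IsBilinearMap.smul_smul {f : V → V → ℝ} (hf : IsBilinearMap ℝ f) (c : ℝ) (v : V) :
    f (c • v) (c • v) = c ^ 2 * f v v := by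
  rw [(hf.left _).map_smul, (hf.right v).map_smul, smul_eq_mul, smul_eq_mul]; ring

theorem _root_.IsBilinearMap.comp {W : Type*} [AddCommGroup W] [Module ℝ W] {f : V → V → ℝ}
    (hf : IsBilinearMap ℝ f) (e : W →ₗ[ℝ] V) : IsBilinearMap ℝ fun v w => f (e v) (e w) :=
  .of_isLinearMap (fun w => ((IsLinearMap.mk' _ (hf.left (e w))) ∘ₗ e).isLinear)
    (fun v => ((IsLinearMap.mk' _ (hf.right (e v))) ∘ₗ e).isLinear)

/-- A linear isomorphism with a Euclidean space, given by an arbitrary basis. -/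
noncomputable def euclideanEquiv (V : Type*) [AddCommGroup V] [Module ℝ V] [FiniteDimensional ℝ V] :
    EuclideanSpace ℝ (Fin (Module.finrank ℝ V)) ≃ₗ[ℝ] V :=
  (EuclideanSpace.equiv _ ℝ).toLinearEquiv.trans (Module.finBasis ℝ V).equivFun.symm

/-- On a finite-dimensional space, every quadratic form is bounded by a multiple of a positive
definite one. -/
theorem _root_.IsBilinearMap.exists_le_mul [FiniteDimensional ℝ V] {f g : V → V → ℝ}
    (hf : IsBilinearMap ℝ f) (hg : IsBilinearMap ℝ g) (hpos : ∀ v, v ≠ 0 → 0 < g v v) :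
    ∃ C : ℝ, 0 < C ∧ ∀ v, f v v ≤ C * g v v := by
  let e := euclideanEquiv V
  have hf' := hf.comp e.toLinearMap
  have hg' := hg.comp e.toLinearMap
  have hfc := hf'.continuous_diag
  have hgc := hg'.continuous_diag
  have hne : ∀ x ∈ Metric.sphere (0 : EuclideanSpace ℝ (Fin (Module.finrank ℝ V))) 1,
      0 < g (e x) (e x) := by
    intro x hx
    refine hpos _ fun h0 => ?_
    have : x = 0 := e.map_eq_zero_iff.1 h0
    rw [this] at hx
    simp at hx
  obtain ⟨C, hC⟩ := (isCompact_sphere (0 : EuclideanSpace ℝ (Fin (Module.finrank ℝ V)))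
    1).exists_bound_of_continuousOn (f := fun x => f (e x) (e x) / g (e x) (e x))
    (hfc.continuousOn.div hgc.continuousOn fun x hx => (hne x hx).ne')
  refine ⟨|C| + 1, by positivity, fun v => ?_⟩
  obtain ⟨x, rfl⟩ := e.surjective v
  by_cases hx : x = 0
  · have h1 := hf'.smul_smul 0 x
    have h2 := hg'.smul_smul 0 x
    simp only [zero_smul, LinearEquiv.coe_coe] at h1 h2
    rw [hx, h1, h2]; simp
  · have hxn : 0 < ‖x‖ := norm_pos_iff.2 hx
    have hu : ‖x‖⁻¹ • x ∈ Metric.sphere (0 : EuclideanSpace ℝ (Fin (Module.finrank ℝ V))) 1 := by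
      simp [norm_smul, hxn.ne']
    have h1 := hC _ hu
    have h2 := hne _ hu
    have h3 := hf'.smul_smul ‖x‖⁻¹ x
    have h4 := hg'.smul_smul ‖x‖⁻¹ x
    simp only [LinearEquiv.coe_coe] at h3 h4
    rw [h4] at h2
    have h5 : 0 < g (e x) (e x) := (pos_iff_pos_of_mul_pos h2).1 (by positivity)
    rw [h3, h4, mul_div_mul_left _ _ (by positivity : ‖x‖⁻¹ ^ 2 ≠ 0)] at h1
    have h6 := (le_abs_self _).trans (h1.trans (le_abs_self C))
    rw [div_le_iff₀ h5] at h6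
    nlinarith

end Forms

/-! ### Solvability of coercive nonlinear equations -/

section Solvability

open Filter Topology

variable {V : Type*} [AddCommGroup V] [Module ℝ V] [TopologicalSpace V] [IsTopologicalAddGroup V]
  [ContinuousSMul ℝ V] [FiniteDimensional ℝ V]

/-- A nonlinear equation in variational form whose diagonal dominates a positive definite quadratic
form has a solution for every linear right-hand side: the residual points outward on large
spheres. -/
theorem exists_solution_of_coercive {F g : V → V → ℝ} {ℓ : V → ℝ}
    (hlin : ∀ u, IsLinearMap ℝ (F u)) (hcont : ∀ w, Continuous fun u => F u w)
    (hg : IsBilinearMap ℝ g) (hpos : ∀ v, v ≠ 0 → 0 < g v v) (hcoer : ∀ u, g u u ≤ F u u)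
    (hℓ : IsLinearMap ℝ ℓ) : ∃ u, ∀ w, F u w = ℓ w := by
  let e := euclideanEquiv V
  have he : Continuous e := e.toLinearMap.continuous_of_finiteDimensional
  -- the residual as a functional on the Euclidean space
  let G : EuclideanSpace ℝ (Fin (Module.finrank ℝ V)) →
      EuclideanSpace ℝ (Fin (Module.finrank ℝ V)) →L[ℝ] ℝ := fun x =>
    LinearMap.toContinuousLinearMap
      ((IsLinearMap.mk' (F (e x)) (hlin (e x)) - IsLinearMap.mk' ℓ hℓ) ∘ₗ e.toLinearMap)
  have hGa : ∀ x y, G x y = F (e x) (e y) - ℓ (e y) := fun x y => rfl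
  have hG : Continuous G := by
    rw [continuous_clm_apply]
    intro y
    simp_rw [hGa]
    exact ((hcont (e y)).comp he).sub continuous_const
  obtain ⟨C, hC, hCle⟩ := IsBilinearMap.exists_le_mul
    (f := fun u v => inner ℝ (e.symm u) (e.symm v))
    (isBilin_inner e.symm.toLinearMap.isLinear e.symm.toLinearMap.isLinear) hg hpos
  let L : EuclideanSpace ℝ (Fin (Module.finrank ℝ V)) →L[ℝ] ℝ :=
    LinearMap.toContinuousLinearMap (IsLinearMap.mk' ℓ hℓ ∘ₗ e.toLinearMap)
  have hLa : ∀ x, L x = ℓ (e x) := fun x => rfl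
  have hRpos : 0 < C * (‖L‖ + 1) := by positivity
  obtain ⟨x, hx⟩ := exists_zero_of_continuous_outward
    (Φ := fun x => (InnerProductSpace.toDual ℝ _).symm (G x))
    ((LinearIsometryEquiv.continuous _).comp hG) hRpos (fun x hx => by
      rw [InnerProductSpace.toDual_symm_apply, hGa]
      have h1 := hCle (e x)
      rw [LinearEquiv.symm_apply_apply, real_inner_self_eq_norm_sq] at h1
      have h2 := hcoer (e x)
      have h3 := (le_abs_self _).trans (L.le_opNorm x)
      rw [hLa] at h3
      have h4 : C * ℓ (e x) < ‖x‖ ^ 2 := by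
        have h5 : C * ℓ (e x) ≤ C * (‖L‖ * ‖x‖) := mul_le_mul_of_nonneg_left h3 hC.le
        have h6 : ‖x‖ ^ 2 = C * (‖L‖ * ‖x‖) + C * ‖x‖ := by
          rw [sq]; nth_rewrite 1 [hx]; ring
        have h7 : 0 < C * ‖x‖ := mul_pos hC (hx ▸ hRpos)
        linarith
      have h8 : C * ℓ (e x) < C * g (e x) (e x) := h4.trans_le h1
      have h9 := lt_of_mul_lt_mul_left h8 hC.le
      linarith)
  refine ⟨e x, fun w => ?_⟩
  have hGx : G x = 0 := (LinearIsometryEquiv.map_eq_zero_iff _).1 hx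
  have h := hGa x (e.symm w)
  rw [hGx, LinearEquiv.apply_symm_apply] at h
  exact (sub_eq_zero.1 h.symm)

end Solvability

namespace Mesh

open Filter Topology

variable {d p : ℕ} {ι κ : Type*} {M : Mesh d ι κ}

/-! ### Traces of broken polynomials -/

theorem contDiff_val (v : M.DGSpace p) (i : ι) : ContDiff ℝ ∞ (val v i) :=
  contDiff_of_mem_localSpace (v i).2

theorem continuous_val (v : M.DGSpace p) (i : ι) : Continuous (val v i) :=
  (contDiff_val v i).continuous

theorem differentiable_val (v : M.DGSpace p) (i : ι) : Differentiable ℝ (val v i) :=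
  (contDiff_val v i).differentiable (by simp)

theorem continuous_grad (v : M.DGSpace p) (i : ι) : Continuous (grad v i) :=
  (LinearIsometryEquiv.continuous _).comp ((contDiff_val v i).continuous_fderiv (by simp))

theorem isLinearMap_val (i : ι) (x : Pt d) : IsLinearMap ℝ fun v : M.DGSpace p => val v i x :=
  ⟨fun _ _ => rfl, fun _ _ => rfl⟩

theorem isLinearMap_grad (i : ι) (x : Pt d) : IsLinearMap ℝ fun v : M.DGSpace p => grad v i x := by
  refine ⟨fun v w => ext_inner_left ℝ fun y => ?_, fun c v => ext_inner_left ℝ fun y => ?_⟩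
  · simp only [grad, inner_add_right, inner_gradient_right]
    have h : val (v + w) i = val v i + val w i := rfl
    rw [h, fderiv_add (differentiable_val v i x) (differentiable_val w i x)]
    rfl
  · simp only [grad, inner_smul_right, inner_gradient_right]
    have h : val (c • v) i = c • val v i := rfl
    rw [h, fderiv_const_smul (differentiable_val v i x)]
    rfl

theorem grad_apply (v : M.DGSpace p) (i : ι) (x : Pt d) (j : Fin d) :
    grad v i x j = fderiv ℝ (val v i) x (EuclideanSpace.single j 1) := by
  rw [← inner_gradient_right, EuclideanSpace.inner_single_left]
  simp [grad]

theorem grad_mem_localSpace (v : M.DGSpace p) (i : ι) (j : Fin d) :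
    (fun x => grad v i x j) ∈ localSpace p (M.kind i) (M.frame i) := by
  simp_rw [grad_apply]
  exact fderiv_mem_localSpace (v i).2 _

theorem continuous_minusVal (v : M.DGSpace p) (k : κ) : Continuous (minusVal v k) := by
  unfold minusVal
  cases M.minus k with
  | none => exact continuous_const
  | some j => exact continuous_val v j

theorem isLinearMap_minusVal (k : κ) (x : Pt d) :
    IsLinearMap ℝ fun v : M.DGSpace p => minusVal v k x := by
  unfold minusVal
  cases M.minus k with
  | none => exact ⟨fun _ _ => (add_zero _).symm, fun _ _ => (smul_zero _).symm⟩
  | some j => exact isLinearMap_val j x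

theorem continuous_avgGrad (v : M.DGSpace p) (k : κ) : Continuous (avgGrad v k) := by
  unfold avgGrad
  cases M.minus k with
  | none => exact continuous_grad v _
  | some j =>
    exact Continuous.const_smul ((continuous_grad v (M.plus k)).add (continuous_grad v j))
      (1 / 2 : ℝ)

theorem isLinearMap_avgGrad (k : κ) (x : Pt d) :
    IsLinearMap ℝ fun v : M.DGSpace p => avgGrad v k x := by
  unfold avgGrad
  cases M.minus k with
  | none => exact isLinearMap_grad _ x
  | some j =>
    exact (((1 / 2 : ℝ)) • (IsLinearMap.mk' _ (isLinearMap_grad (p := p) (M.plus k) x)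
      + IsLinearMap.mk' _ (isLinearMap_grad (p := p) j x))).isLinear

theorem continuous_sjump (v : M.DGSpace p) (k : κ) : Continuous (sjump v k) :=
  (continuous_val v _).sub (continuous_minusVal v k)

theorem isLinearMap_sjump (k : κ) (x : Pt d) :
    IsLinearMap ℝ fun v : M.DGSpace p => sjump v k x :=
  (IsLinearMap.mk' _ (isLinearMap_val (p := p) (M.plus k) x)
    - IsLinearMap.mk' _ (isLinearMap_minusVal (p := p) k x)).isLinear

theorem continuous_jump (v : M.DGSpace p) (k : κ) : Continuous (jump v k) :=
  (continuous_sjump v k).smul continuous_const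

theorem isLinearMap_jump (k : κ) (x : Pt d) :
    IsLinearMap ℝ fun v : M.DGSpace p => jump v k x :=
  ((IsLinearMap.mk' _ (isLinearMap_sjump (p := p) k x)).smulRight (M.normal k)).isLinear

theorem upwindFlux_eq (b : Pt d → Pt d) (v : M.DGSpace p) (k : κ) (x : Pt d) :
    upwindFlux b v k x = max (inner ℝ (b x) (M.normal k)) 0 * val v (M.plus k) x
      + min (inner ℝ (b x) (M.normal k)) 0 * minusVal v k x := by
  unfold upwindFlux
  split_ifs with h
  · rw [max_eq_left h, min_eq_right h, zero_mul, add_zero]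
  · rw [max_eq_right (not_le.1 h).le, min_eq_left (not_le.1 h).le, zero_mul, zero_add]

theorem isLinearMap_upwindFlux (b : Pt d → Pt d) (k : κ) (x : Pt d) :
    IsLinearMap ℝ fun v : M.DGSpace p => upwindFlux b v k x := by
  simp_rw [upwindFlux_eq]
  exact isLinearMap_add (isLinearMap_const_mul _ (isLinearMap_val _ x))
    (isLinearMap_const_mul _ (isLinearMap_minusVal k x))

theorem face_subset_closure_domain (M : Mesh d ι κ) (k : κ) : M.face k ⊆ closure M.domain :=
  (M.face_subset_cell (M.adj_plus k)).trans (M.cell_subset_closure_domain _)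

theorem continuousOn_upwindFlux {b : Pt d → Pt d} (hb : ContinuousOn b (closure M.domain))
    (v : M.DGSpace p) (k : κ) : ContinuousOn (upwindFlux b v k) (M.face k) := by
  have h1 : upwindFlux b v k = fun x => max (inner ℝ (b x) (M.normal k)) 0 * val v (M.plus k) x
      + min (inner ℝ (b x) (M.normal k)) 0 * minusVal v k x := funext (upwindFlux_eq b v k)
  have hbn : ContinuousOn (fun x => inner ℝ (b x) (M.normal k)) (M.face k) :=
    (hb.mono (M.face_subset_closure_domain k)).inner continuousOn_const
  rw [h1]
  exact ((hbn.sup continuousOn_const).mul (continuous_val v _).continuousOn).add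
    ((hbn.inf continuousOn_const).mul (continuous_minusVal v k).continuousOn)

theorem continuousOn_integrableOn_cell (M : Mesh d ι κ) (i : ι) {f : Pt d → ℝ}
    (hf : ContinuousOn f (M.cell i)) : IntegrableOn f (M.cell i) :=
  hf.integrableOn_compact (M.cell_isCompact i)

/-! ### The discrete trace inequality -/

theorem exists_isTraceConstant [Fintype ι] [Fintype κ] (M : Mesh d ι κ) (p : ℕ) :
    ∃ C : ℝ, M.IsTraceConstant p C := by
  have h : ∀ (k : κ) (i : ι), ∃ C : ℝ, 0 < C ∧ ∀ v ∈ localSpace p (M.kind i) (M.frame i),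
      M.faceSize k * ∫ x in M.face k, v x ^ 2 ∂μHE[d - 1] ≤ C * ∫ x in M.cell i, v x ^ 2 := by
    intro k i
    let W := localSpace p (M.kind i) (M.frame i)
    have hval : ∀ x : Pt d, IsLinearMap ℝ fun v : W => (v : Pt d → ℝ) x :=
      fun x => ⟨fun _ _ => rfl, fun _ _ => rfl⟩
    have hc : ∀ v : W, Continuous (v : Pt d → ℝ) := fun v => continuous_of_mem_localSpace v.2
    have hf : IsBilinearMap ℝ fun v w : W =>
        M.faceSize k * ∫ x in M.face k, (v : Pt d → ℝ) x * (w : Pt d → ℝ) x ∂μHE[d - 1] :=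
      IsBilinearMap.const_mul _ (IsBilinearMap.integral (fun x => isBilin_mul (hval x) (hval x))
        fun v w => M.continuousOn_integrableOn_face k ((hc v).mul (hc w)).continuousOn)
    have hg : IsBilinearMap ℝ fun v w : W =>
        ∫ x in M.cell i, (v : Pt d → ℝ) x * (w : Pt d → ℝ) x :=
      IsBilinearMap.integral (fun x => isBilin_mul (hval x) (hval x))
        fun v w => M.continuousOn_integrableOn_cell i ((hc v).mul (hc w)).continuousOn
    obtain ⟨C, hC, hle⟩ := hf.exists_le_mul hg (fun v hv => by
      simp_rw [← sq]
      refine lt_of_le_of_ne (integral_nonneg fun x => sq_nonneg _) fun h0 => hv ?_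
      exact Subtype.ext (eq_zero_of_setIntegral_sq_eq_zero v.2 (M.cell_isCompact i)
        (M.cell_interior i) h0.symm))
    refine ⟨C, hC, fun v hv => ?_⟩
    have := hle ⟨v, hv⟩
    simpa only [← sq] using this
  choose C hC hle using h
  refine ⟨√(∑ k, ∑ i, C k i), Real.sqrt_nonneg _, fun k i _ v hv => ?_⟩
  rw [← Real.sqrt_mul (M.faceSize_pos k).le,
    ← Real.sqrt_mul (Finset.sum_nonneg fun k _ => Finset.sum_nonneg fun i _ => (hC k i).le)]
  refine Real.sqrt_le_sqrt ((hle k i v hv).trans ?_)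
  refine mul_le_mul_of_nonneg_right ?_ (integral_nonneg fun x => sq_nonneg _)
  exact (Finset.single_le_sum (f := fun i => C k i) (fun i _ => (hC k i).le)
    (Finset.mem_univ i)).trans (Finset.single_le_sum (f := fun k => ∑ i, C k i)
      (fun k _ => Finset.sum_nonneg fun i _ => (hC k i).le) (Finset.mem_univ k))

/-- The discrete trace inequality for the gradients of broken polynomials. -/
theorem IsTraceConstant.grad_le {C : ℝ} (hC : M.IsTraceConstant p C) {k : κ} {i : ι}
    (hki : M.Adj k i) (v : M.DGSpace p) :
    M.faceSize k * ∫ x in M.face k, ‖grad v i x‖ ^ 2 ∂μHE[d - 1]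
      ≤ C ^ 2 * ∫ x in M.cell i, ‖grad v i x‖ ^ 2 := by
  have hsq : ∀ x, ‖grad v i x‖ ^ 2 = ∑ j, grad v i x j ^ 2 := fun x => by
    rw [EuclideanSpace.norm_sq_eq]; simp
  have hc : ∀ j, Continuous fun x => grad v i x j ^ 2 := fun j =>
    (continuous_of_mem_localSpace (grad_mem_localSpace v i j)).pow 2
  simp_rw [hsq]
  rw [integral_finsetSum _ fun j _ => M.continuousOn_integrableOn_face k (hc j).continuousOn,
    integral_finsetSum _ fun j _ => M.continuousOn_integrableOn_cell i (hc j).continuousOn,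
    Finset.mul_sum, Finset.mul_sum]
  refine Finset.sum_le_sum fun j _ => ?_
  have h1 := hC.2 k i hki _ (grad_mem_localSpace v i j)
  have h2 := pow_le_pow_left₀ (by positivity) h1 2
  have h3 : 0 ≤ ∫ x in M.face k, grad v i x j ^ 2 ∂μHE[d - 1] :=
    integral_nonneg fun x => sq_nonneg _
  have h4 : 0 ≤ ∫ x in M.cell i, grad v i x j ^ 2 := integral_nonneg fun x => sq_nonneg _
  rwa [mul_pow, mul_pow, Real.sq_sqrt (M.faceSize_pos k).le, Real.sq_sqrt h3, Real.sq_sqrt h4] at h2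

/-! ### Coercivity -/

/-- Young's inequality for the consistency terms of the interior penalty form on a face. -/
theorem two_mul_inner_sub_le {η h : ℝ} (hη : 0 < η) (hh : 0 < h) (a s : Pt d) :
    inner ℝ a s + inner ℝ a s - η / h * inner ℝ s s ≤ h / η * ‖a‖ ^ 2 := by
  have h0 : 0 ≤ ‖(h / η) • a - s‖ ^ 2 := sq_nonneg _
  rw [norm_sub_sq_real, inner_smul_left, norm_smul, mul_pow,
    Real.norm_of_nonneg (by positivity)] at h0
  rw [real_inner_self_eq_norm_sq]
  have h1 : 0 ≤ η / h * ((h / η) ^ 2 * ‖a‖ ^ 2 - 2 * (h / η * inner ℝ a s) + ‖s‖ ^ 2) :=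
    mul_nonneg (by positivity) h0
  have h2 : η / h * ((h / η) ^ 2 * ‖a‖ ^ 2 - 2 * (h / η * inner ℝ a s) + ‖s‖ ^ 2)
      = h / η * ‖a‖ ^ 2 - 2 * inner ℝ a s + η / h * ‖s‖ ^ 2 := by
    field_simp
  linarith

/-- The squared gradient average is bounded by the squared one-sided gradients. -/
theorem norm_avgGrad_sq_le (v : M.DGSpace p) (k : κ) (x : Pt d) :
    ‖avgGrad v k x‖ ^ 2
      ≤ ‖grad v (M.plus k) x‖ ^ 2 + (M.minus k).elim 0 fun j => ‖grad v j x‖ ^ 2 := by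
  unfold avgGrad
  cases M.minus k with
  | none => simp
  | some j =>
    simp only
    have h1 := norm_add_le (grad v (M.plus k) x) (grad v j x)
    have h2 := norm_nonneg (grad v (M.plus k) x + grad v j x)
    rw [norm_smul, mul_pow]
    have h3 := pow_le_pow_left₀ h2 h1 2
    norm_num
    nlinarith [sq_nonneg (‖grad v (M.plus k) x‖ - ‖grad v j x‖)]

/-- On each face, the upwind flux dominates the boundary terms that integration by parts leaves. -/
theorem upwindFlux_mul_sjump_ge (b : Pt d → Pt d) (v : M.DGSpace p) (k : κ) (x : Pt d) :
    0 ≤ upwindFlux b v k x * sjump v k x - 1 / 2 * (inner ℝ (M.normal k) (b x)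
      * (val v (M.plus k) x ^ 2 - minusVal v k x ^ 2)) := by
  rw [real_inner_comm]
  unfold upwindFlux sjump
  split_ifs with h
  · have := mul_nonneg h (sq_nonneg (val v (M.plus k) x - minusVal v k x))
    nlinarith
  · have h' := (not_le.1 h).le
    have := mul_nonneg (neg_nonneg.2 h') (sq_nonneg (val v (M.plus k) x - minusVal v k x))
    nlinarith

theorem integrableOn_coefficient_mul (M : Mesh d ι κ) {f g : Pt d → ℝ} {q : ENNReal} (hq : 1 ≤ q)
    (hf : MemLp f q (volume.restrict M.domain)) (i : ι) (hg : Continuous g) :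
    IntegrableOn (fun x => f x * g x) (M.cell i) := by
  have : IsFiniteMeasure (volume.restrict (M.cell i)) :=
    isFiniteMeasure_restrict.2 (M.cell_isCompact i).measure_lt_top.ne
  have h1 : IntegrableOn f (M.cell i) :=
    (memLp_restrict_of_interior_subset (M.cell_convex i) (M.interior_cell_subset_domain i)
      hf).integrable hq
  exact h1.mul_continuousOn hg.continuousOn (M.cell_isCompact i)

theorem memLp_divb (D : Coefficients M.domain) : MemLp D.divb ⊤ (volume.restrict M.domain) :=
  memLp_finsetSum _ fun i _ => (D.b_W1Inf i).memLp_deriv i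

theorem continuousOn_b_cell (D : Coefficients M.domain) (i : ι) : ContinuousOn D.b (M.cell i) :=
  D.b_cont.mono (M.cell_subset_closure_domain i)

section Coercivity

variable [Fintype ι] [Fintype κ]

theorem card_adjFaces_le (M : Mesh d ι κ) (i : ι) : (M.adjFaces i).card ≤ M.maxFaces := by
  have h : (M.adjFaces i).card = Nat.card {k : κ // M.Adj k i} := by
    classical
    rw [Nat.card_eq_fintype_card, Fintype.card_subtype, adjFaces]
  rw [h]
  exact Finset.le_sup (f := fun i => Nat.card {k : κ // M.Adj k i}) (Finset.mem_univ i)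

/-- The interior penalty form is nonnegative above the threshold for the penalty parameter. -/
theorem diffusion_nonneg {C : ℝ} (hC : M.IsTraceConstant p C) {η : ℝ}
    (hη : C ^ 2 * M.maxFaces < η) (v : M.DGSpace p) :
    0 ≤ (∑ i, ∫ x in M.cell i, inner ℝ (grad v i x) (grad v i x))
      - ∑ k, ∫ x in M.face k,
          (inner ℝ (avgGrad v k x) (jump v k x) + inner ℝ (avgGrad v k x) (jump v k x)
            - η / M.faceSize k * inner ℝ (jump v k x) (jump v k x)) ∂μHE[d - 1] := by
  have hη0 : 0 < η := lt_of_le_of_lt (by positivity) hη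
  let I : ι → ℝ := fun i => ∫ x in M.cell i, ‖grad v i x‖ ^ 2
  let J : κ → ι → ℝ := fun k i => ∫ x in M.face k, ‖grad v i x‖ ^ 2 ∂μHE[d - 1]
  have hI : ∀ i, 0 ≤ I i := fun i => integral_nonneg fun x => sq_nonneg _
  have hint : ∀ k i, IntegrableOn (fun x => ‖grad v i x‖ ^ 2) (M.face k) (μHE[d - 1]) := fun k i =>
    M.continuousOn_integrableOn_face k ((continuous_grad v i).norm.pow 2).continuousOn
  have hface : ∀ k, ∫ x in M.face k,
          (inner ℝ (avgGrad v k x) (jump v k x) + inner ℝ (avgGrad v k x) (jump v k x)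
            - η / M.faceSize k * inner ℝ (jump v k x) (jump v k x)) ∂μHE[d - 1]
      ≤ M.faceSize k / η * J k (M.plus k)
        + (M.minus k).elim 0 fun j => M.faceSize k / η * J k j := by
    intro k
    have hca := continuous_avgGrad v k
    have hcj := continuous_jump v k
    have h1 : ∫ x in M.face k,
          (inner ℝ (avgGrad v k x) (jump v k x) + inner ℝ (avgGrad v k x) (jump v k x)
            - η / M.faceSize k * inner ℝ (jump v k x) (jump v k x)) ∂μHE[d - 1]
        ≤ ∫ x in M.face k, M.faceSize k / η * ‖avgGrad v k x‖ ^ 2 ∂μHE[d - 1] := by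
      refine integral_mono (M.continuousOn_integrableOn_face k (Continuous.continuousOn ?_))
        (M.continuousOn_integrableOn_face k (Continuous.continuousOn ?_))
        fun x => two_mul_inner_sub_le hη0 (M.faceSize_pos k) _ _
      · exact ((hca.inner hcj).add (hca.inner hcj)).sub (continuous_const.mul (hcj.inner hcj))
      · exact continuous_const.mul (hca.norm.pow 2)
    refine h1.trans ?_
    rw [integral_const_mul]
    have h2 : 0 ≤ M.faceSize k / η := div_nonneg (M.faceSize_pos k).le hη0.le
    have h3 : ∫ x in M.face k, ‖avgGrad v k x‖ ^ 2 ∂μHE[d - 1]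
        ≤ J k (M.plus k) + (M.minus k).elim 0 fun j => J k j := by
      have h4 := norm_avgGrad_sq_le v k
      have h5 : IntegrableOn (fun x => ‖avgGrad v k x‖ ^ 2) (M.face k) (μHE[d - 1]) :=
        M.continuousOn_integrableOn_face k (hca.norm.pow 2).continuousOn
      cases hm : M.minus k with
      | none =>
        simp only [hm, Option.elim_none, add_zero] at h4 ⊢
        exact integral_mono h5 (hint _ _) h4
      | some j =>
        simp only [hm, Option.elim_some] at h4 ⊢
        rw [← integral_add (hint _ _) (hint _ _)]
        exact integral_mono h5 ((hint _ _).add (hint _ _)) h4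
    refine (mul_le_mul_of_nonneg_left h3 h2).trans_eq ?_
    cases hm : M.minus k <;> simp [mul_add]
  have hsum : ∑ k, (M.faceSize k / η * J k (M.plus k)
      + (M.minus k).elim 0 fun j => M.faceSize k / η * J k j) ≤ ∑ i, I i := by
    rw [← M.sum_adjFaces fun k i => M.faceSize k / η * J k i]
    refine Finset.sum_le_sum fun i _ => ?_
    have h1 : ∀ k ∈ M.adjFaces i, M.faceSize k / η * J k i ≤ C ^ 2 * I i / η := by
      intro k hk
      rw [div_mul_eq_mul_div]
      exact div_le_div_of_nonneg_right (hC.grad_le (M.mem_adjFaces.1 hk) v) hη0.le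
    refine (Finset.sum_le_card_nsmul _ _ _ h1).trans ?_
    rw [nsmul_eq_mul, ← mul_div_assoc, div_le_iff₀ hη0]
    have h2 : ((M.adjFaces i).card : ℝ) ≤ M.maxFaces := by exact_mod_cast M.card_adjFaces_le i
    calc ((M.adjFaces i).card : ℝ) * (C ^ 2 * I i) ≤ M.maxFaces * (C ^ 2 * I i) :=
          mul_le_mul_of_nonneg_right h2 (mul_nonneg (sq_nonneg _) (hI i))
      _ = (C ^ 2 * M.maxFaces) * I i := by ring
      _ ≤ η * I i := mul_le_mul_of_nonneg_right hη.le (hI i)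
      _ = I i * η := mul_comm _ _
  have hcell : ∑ i, ∫ x in M.cell i, inner ℝ (grad v i x) (grad v i x) = ∑ i, I i := by
    simp only [real_inner_self_eq_norm_sq, I]
  rw [hcell, sub_nonneg]
  exact (Finset.sum_le_sum fun k _ => hface k).trans hsum

/-- Coercivity of the convective and reactive part: integration by parts on each element turns the
volume terms into `(c - ½ ∇·b) v²`, and upwinding makes the remaining face terms nonnegative. -/
theorem convection_ge (D : Coefficients M.domain) (v : M.DGSpace p) :
    D.σ₀ * ∑ i, ∫ x in M.cell i, val v i x * val v i x
      ≤ -(∑ i, ∫ x in M.cell i, val v i x * inner ℝ (D.b x) (grad v i x))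
        + (∑ k, ∫ x in M.face k, upwindFlux D.b v k x * sjump v k x ∂μHE[d - 1])
        + ∑ i, ∫ x in M.cell i, (D.c x - D.divb x) * val v i x * val v i x := by
  have hv := continuous_val v
  have hsq : ∀ i, Continuous fun x => val v i x * val v i x := fun i => (hv i).mul (hv i)
  have hdiv : ∀ i, IntegrableOn (fun x => D.divb x * (val v i x * val v i x)) (M.cell i) := fun i =>
    M.integrableOn_coefficient_mul le_top (memLp_divb D) i (hsq i)
  have hc : ∀ i, IntegrableOn (fun x => D.c x * (val v i x * val v i x)) (M.cell i) := fun i =>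
    M.integrableOn_coefficient_mul le_top D.c_memLp i (hsq i)
  have hbg : ∀ i, IntegrableOn (fun x => val v i x * inner ℝ (D.b x) (grad v i x)) (M.cell i) :=
    fun i => M.continuousOn_integrableOn_cell i
      ((hv i).continuousOn.mul ((continuousOn_b_cell D i).inner (continuous_grad v i).continuousOn))
  let B : κ → ι → ℝ := fun k i =>
    ∫ x in M.face k, inner ℝ (M.outNormal k i) (D.b x) * (val v i x * val v i x) ∂μHE[d - 1]
  have hparts : ∀ i, ∫ x in M.cell i, val v i x * inner ℝ (D.b x) (grad v i x)
      = 1 / 2 * ∑ k ∈ M.adjFaces i, B k i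
        - 1 / 2 * ∫ x in M.cell i, D.divb x * (val v i x * val v i x) := by
    intro i
    have h1 := M.integral_divergence_cell D i ((contDiff_val v i).mul (contDiff_val v i))
    have h2 : ∀ x, inner ℝ (D.b x) (∇ (fun x => val v i x * val v i x) x)
        = 2 * (val v i x * inner ℝ (D.b x) (grad v i x)) := by
      intro x
      rw [grad, inner_gradient_right, inner_gradient_right,
        fderiv_fun_mul (differentiable_val v i x) (differentiable_val v i x)]
      simp; ring
    simp_rw [h2] at h1
    rw [integral_add ((hbg i).const_mul 2) (hdiv i), integral_const_mul] at h1
    simp only [B]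
    linarith
  have hreact : ∀ i, ∫ x in M.cell i, (D.c x - D.divb x) * val v i x * val v i x
      = (∫ x in M.cell i, D.c x * (val v i x * val v i x))
        - ∫ x in M.cell i, D.divb x * (val v i x * val v i x) := by
    intro i
    rw [← integral_sub (hc i) (hdiv i)]
    refine integral_congr_ae (Eventually.of_forall fun x => ?_)
    simp only; ring
  have hσ : ∀ i, D.σ₀ * ∫ x in M.cell i, val v i x * val v i x
      ≤ (∫ x in M.cell i, D.c x * (val v i x * val v i x))
        - 1 / 2 * ∫ x in M.cell i, D.divb x * (val v i x * val v i x) := by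
    intro i
    rw [← integral_const_mul, ← integral_const_mul, ← integral_sub (hc i) ((hdiv i).const_mul _)]
    refine integral_mono_ae ((M.continuousOn_integrableOn_cell i (hsq i).continuousOn).const_mul _)
      ((hc i).sub ((hdiv i).const_mul _)) ?_
    have h1 : (interior (M.cell i) : Set (Pt d)) =ᵐ[volume] M.cell i :=
      interior_ae_eq_of_null_frontier ((M.cell_convex i).addHaar_frontier volume)
    rw [← Measure.restrict_congr_set h1]
    filter_upwards [ae_restrict_of_ae_restrict_of_subset (M.interior_cell_subset_domain i)
      D.σ_ge] with x hx
    have h2 := mul_le_mul_of_nonneg_right hx (mul_self_nonneg (val v i x))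
    simp only [Coefficients.divb]
    linarith
  have hfaces : ∑ i, ∑ k ∈ M.adjFaces i, B k i
      ≤ 2 * ∑ k, ∫ x in M.face k, upwindFlux D.b v k x * sjump v k x ∂μHE[d - 1] := by
    rw [M.sum_adjFaces B, Finset.mul_sum]
    refine Finset.sum_le_sum fun k _ => ?_
    have hbn : ContinuousOn (fun x => inner ℝ (M.normal k) (D.b x)) (M.face k) :=
      continuousOn_const.inner (D.b_cont.mono (M.face_subset_closure_domain k))
    have hm := continuous_minusVal v k
    have hi1 : IntegrableOn (fun x => inner ℝ (M.normal k) (D.b x)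
        * (val v (M.plus k) x * val v (M.plus k) x)) (M.face k) (μHE[d - 1]) :=
      M.continuousOn_integrableOn_face k (hbn.mul (hsq _).continuousOn)
    have hi2 : IntegrableOn (fun x => inner ℝ (M.normal k) (D.b x)
        * (minusVal v k x * minusVal v k x)) (M.face k) (μHE[d - 1]) :=
      M.continuousOn_integrableOn_face k (hbn.mul (hm.mul hm).continuousOn)
    have hi3 : IntegrableOn (fun x => upwindFlux D.b v k x * sjump v k x) (M.face k) (μHE[d - 1]) :=
      M.continuousOn_integrableOn_face k
        ((continuousOn_upwindFlux D.b_cont v k).mul (continuous_sjump v k).continuousOn)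
    have hB : (B k (M.plus k) + (M.minus k).elim 0 fun j => B k j)
        = (∫ x in M.face k, inner ℝ (M.normal k) (D.b x)
            * (val v (M.plus k) x * val v (M.plus k) x) ∂μHE[d - 1])
          - ∫ x in M.face k, inner ℝ (M.normal k) (D.b x)
            * (minusVal v k x * minusVal v k x) ∂μHE[d - 1] := by
      rw [sub_eq_add_neg]
      congr 1
      · simp only [B, outNormal_plus]
      · cases hmk : M.minus k with
        | none => simp [minusVal, hmk]
        | some j =>
          simp only [B, Option.elim_some, M.outNormal_minus hmk, minusVal, hmk]
          rw [← integral_neg]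
          simp [inner_neg_left]
    rw [hB, ← integral_sub hi1 hi2, ← integral_const_mul]
    refine integral_mono (hi1.sub hi2) (hi3.const_mul 2) fun x => ?_
    have := upwindFlux_mul_sjump_ge D.b v k x
    simp only
    nlinarith
  rw [Finset.mul_sum]
  refine (Finset.sum_le_sum fun i _ => hσ i).trans ?_
  simp_rw [hparts, hreact]
  rw [Finset.sum_sub_distrib, Finset.sum_sub_distrib, Finset.sum_sub_distrib, ← Finset.mul_sum,
    ← Finset.mul_sum]
  linarith

/-- Coercivity of the bilinear form in `L²`. -/
theorem bilin_ge {C : ℝ} (hC : M.IsTraceConstant p C) {η : ℝ} (hη : C ^ 2 * M.maxFaces < η)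
    (D : Coefficients M.domain) (v : M.DGSpace p) :
    D.σ₀ * ∑ i, ∫ x in M.cell i, val v i x * val v i x ≤ M.bilin D η v v := by
  have h1 := mul_nonneg D.ε_pos.le (diffusion_nonneg hC hη v)
  have h2 := convection_ge D v
  unfold bilin
  linarith

end Coercivity

/-! ### Linearity and continuity of the forms of the scheme -/

theorem isBilinearMap_stiffness (M : Mesh d ι κ) (p : ℕ) (i : ι) :
    IsBilinearMap ℝ fun v w : M.DGSpace p =>
      ∫ x in M.cell i, inner ℝ (grad w i x) (grad v i x) :=
  .integral (fun x => (isBilin_inner (isLinearMap_grad i x) (isLinearMap_grad i x)).flip)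
    fun v w => M.continuousOn_integrableOn_cell i
      ((continuous_grad w i).inner (continuous_grad v i)).continuousOn

section Forms

variable [Fintype ι]

theorem isBilinearMap_mass (M : Mesh d ι κ) (p : ℕ) :
    IsBilinearMap ℝ fun v w : M.DGSpace p => ∑ i, ∫ x in M.cell i, val v i x * val w i x :=
  .sum _ fun i _ => .integral (fun x => isBilin_mul (isLinearMap_val i x) (isLinearMap_val i x))
    fun v w => M.continuousOn_integrableOn_cell i
      ((continuous_val v i).mul (continuous_val w i)).continuousOn

theorem mass_pos {v : M.DGSpace p} (hv : v ≠ 0) :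
    0 < ∑ i, ∫ x in M.cell i, val v i x * val v i x := by
  simp_rw [← sq]
  have h0 : ∀ i ∈ Finset.univ, 0 ≤ ∫ x in M.cell i, val v i x ^ 2 := fun i _ =>
    integral_nonneg fun x => sq_nonneg _
  refine lt_of_le_of_ne (Finset.sum_nonneg h0) fun h => hv (funext fun i => Subtype.ext ?_)
  exact eq_zero_of_setIntegral_sq_eq_zero (v i).2 (M.cell_isCompact i) (M.cell_interior i)
    ((Finset.sum_eq_zero_iff_of_nonneg h0).1 h.symm i (Finset.mem_univ i))

theorem isBilinearMap_bilin [Fintype κ] (D : Coefficients M.domain) (η : ℝ) :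
    IsBilinearMap ℝ (M.bilin (p := p) D η) := by
  have hdiff : ∀ k, IsBilinearMap ℝ fun v w : M.DGSpace p => ∫ x in M.face k,
      (inner ℝ (avgGrad w k x) (jump v k x) + inner ℝ (avgGrad v k x) (jump w k x)
        - η / M.faceSize k * inner ℝ (jump w k x) (jump v k x)) ∂μHE[d - 1] := by
    refine fun k => .integral (fun x => ?_) fun v w => M.continuousOn_integrableOn_face k ?_
    · have ha := isLinearMap_avgGrad (M := M) (p := p) k x
      have hj := isLinearMap_jump (M := M) (p := p) k x
      exact ((isBilin_inner ha hj).flip.add (isBilin_inner ha hj)).sub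
        ((isBilin_inner hj hj).flip.const_mul _)
    · exact ((((continuous_avgGrad w k).inner (continuous_jump v k)).add
        ((continuous_avgGrad v k).inner (continuous_jump w k))).sub
        (continuous_const.mul ((continuous_jump w k).inner (continuous_jump v k)))).continuousOn
  have hconv : ∀ i, IsBilinearMap ℝ fun v w : M.DGSpace p =>
      ∫ x in M.cell i, val v i x * inner ℝ (D.b x) (grad w i x) := by
    refine fun i => .integral (fun x => isBilin_mul (isLinearMap_val i x) ?_)
      fun v w => M.continuousOn_integrableOn_cell i ((continuous_val v i).continuousOn.mul
        ((continuousOn_b_cell D i).inner (continuous_grad w i).continuousOn))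
    exact ((innerₗ (Pt d) (D.b x)) ∘ₗ IsLinearMap.mk' _ (isLinearMap_grad i x)).isLinear
  have hflux : ∀ k, IsBilinearMap ℝ fun v w : M.DGSpace p =>
      ∫ x in M.face k, upwindFlux D.b v k x * sjump w k x ∂μHE[d - 1] := fun k =>
    .integral (fun x => isBilin_mul (isLinearMap_upwindFlux D.b k x) (isLinearMap_sjump k x))
      fun v w => M.continuousOn_integrableOn_face k
        ((continuousOn_upwindFlux D.b_cont v k).mul (continuous_sjump w k).continuousOn)
  have hreact : ∀ i, IsBilinearMap ℝ fun v w : M.DGSpace p =>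
      ∫ x in M.cell i, (D.c x - D.divb x) * val v i x * val w i x := by
    refine fun i => .integral (fun x => isBilin_mul (isLinearMap_const_mul _ (isLinearMap_val i x))
      (isLinearMap_val i x)) fun v w => ?_
    simp_rw [mul_assoc]
    exact M.integrableOn_coefficient_mul le_top (D.c_memLp.sub (memLp_divb D)) i
      ((continuous_val v i).mul (continuous_val w i))
  exact (((((IsBilinearMap.sum _ fun i _ => M.isBilinearMap_stiffness p i).sub
    (.sum _ fun k _ => hdiff k)).const_mul D.ε).sub (.sum _ fun i _ => hconv i)).add
    (.sum _ fun k _ => hflux k)).add (.sum _ fun i _ => hreact i)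

/-- A broken function that belongs to the DG space is its own `L²` projection. -/
theorem l2Proj_val (v : M.DGSpace p) : M.l2Proj p (val v) = v := by
  have hself : M.IsL2Projection (val v) v := fun w => by simp
  have hq : M.IsL2Projection (val v) (M.l2Proj p (val v)) := Classical.epsilon_spec ⟨v, hself⟩
  by_contra hne
  have h := mass_pos (sub_ne_zero.2 (Ne.symm hne))
  exact h.ne' (hq (v - M.l2Proj p (val v)))

/-- The partial derivatives of a broken polynomial are again in the DG space, so that its gradient
has no fluctuation. -/
theorem fluctuation_eq_zero (v : M.DGSpace p) (i : ι) (x : Pt d) : M.fluctuation v i x = 0 := by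
  have h : ∀ j, M.l2Proj p (fun i x => grad v i x j)
      = fun i => ⟨fun x => grad v i x j, grad_mem_localSpace v i j⟩ := fun j =>
    l2Proj_val (M := M) (p := p) fun i => ⟨fun x => grad v i x j, grad_mem_localSpace v i j⟩
  ext j
  simp [fluctuation, h, val]

theorem stab_eq (D : Coefficients M.domain) (γ : M.DGSpace p → ι → ℝ) (u v w : M.DGSpace p) :
    M.stab D γ u v w = ∑ i, (1 - γ u i) * (M.viscosity p D i *
      ∫ x in M.cell i, inner ℝ (grad w i x) (grad v i x)) := by
  simp [stab, fluctuation_eq_zero]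

theorem isLinearMap_stab (D : Coefficients M.domain) (γ : M.DGSpace p → ι → ℝ)
    (u v : M.DGSpace p) : IsLinearMap ℝ (M.stab D γ u v) := by
  have h : M.stab D γ u v = fun w => ∑ i, (1 - γ u i) * (M.viscosity p D i *
      ∫ x in M.cell i, inner ℝ (grad w i x) (grad v i x)) := funext (stab_eq D γ u v)
  rw [h]
  exact isLinearMap_sum _ fun i _ => isLinearMap_const_mul _
    (isLinearMap_const_mul _ ((M.isBilinearMap_stiffness p i).right v))

theorem stab_nonneg (D : Coefficients M.domain) {γ : M.DGSpace p → ι → ℝ}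
    (hγ : ∀ v i, γ v i ≤ 1) (u v : M.DGSpace p) : 0 ≤ M.stab D γ u v v := by
  rw [stab_eq]
  refine Finset.sum_nonneg fun i _ => mul_nonneg (sub_nonneg.2 (hγ u i)) (mul_nonneg ?_ ?_)
  · exact div_nonneg (mul_nonneg ENNReal.toReal_nonneg Metric.diam_nonneg) (by positivity)
  · exact integral_nonneg fun x => real_inner_self_nonneg

theorem continuous_of_isLinearMap {f : M.DGSpace p → ℝ} (hf : IsLinearMap ℝ f) : Continuous f :=
  (IsLinearMap.mk' f hf).continuous_of_finiteDimensional

theorem continuous_stab (D : Coefficients M.domain) {γ : M.DGSpace p → ι → ℝ}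
    (hγ : Continuous γ) (w : M.DGSpace p) : Continuous fun u => M.stab D γ u u w := by
  simp_rw [stab_eq]
  exact continuous_finsetSum _ fun i _ =>
    (continuous_const.sub ((continuous_apply i).comp hγ)).mul
      (continuous_const.mul (continuous_of_isLinearMap ((M.isBilinearMap_stiffness p i).left w)))

/-! ### The consistent right-hand side -/

/-- Boundary faces lie on the boundary of the domain itself: since the union of the elements is
the closure of its interior, it has the same boundary as the domain. -/
theorem face_subset_frontier_domain (M : Mesh d ι κ) {k : κ} (hk : M.minus k = none) :
    M.face k ⊆ frontier M.domain := by
  have hclosed : IsClosed (⋃ i, M.cell i) :=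
    isClosed_iUnion_of_finite fun i => (M.cell_isCompact i).isClosed
  have hreg : (⋃ i, M.cell i) ⊆ closure M.domain :=
    Set.iUnion_subset fun i => M.cell_subset_closure_domain i
  intro x hx
  have h := M.face_boundary k hk hx
  rw [frontier, hclosed.closure_eq] at h
  exact ⟨hreg h.1, fun hi => h.2 (interior_subset hi)⟩

theorem isLinearMap_rhs [Fintype κ] (D : Coefficients M.domain) (η : ℝ) {g uD : Pt d → ℝ}
    (hg : MemLp g 2 (volume.restrict M.domain))
    (huD : MemLp uD 2 ((μHE[d - 1] : Measure (Pt d)).restrict (frontier M.domain))) :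
    IsLinearMap ℝ (M.rhs (p := p) D η g uD) := by
  refine isLinearMap_add (isLinearMap_sum _ fun i _ => isLinearMap_integral
    (fun x => isLinearMap_const_mul _ (isLinearMap_val i x)) fun w =>
      M.integrableOn_coefficient_mul one_le_two hg i (continuous_val w i))
    (isLinearMap_sum _ fun k _ => ?_)
  split_ifs with hk
  · have hfin : IsFiniteMeasure ((μHE[d - 1] : Measure (Pt d)).restrict (M.face k)) :=
      isFiniteMeasure_restrict.2 (M.face_measure_lt_top k).ne
    have hu : IntegrableOn uD (M.face k) (μHE[d - 1]) :=
      (huD.mono_measure (Measure.restrict_mono_set _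
        (M.face_subset_frontier_domain hk))).integrable one_le_two
    have hbn : ContinuousOn (fun x => min (inner ℝ (D.b x) (M.normal k)) 0) (M.face k) :=
      ((D.b_cont.mono (M.face_subset_closure_domain k)).inner continuousOn_const).inf
        continuousOn_const
    refine isLinearMap_integral (fun x => ?_) fun w => hu.continuousOn_mul ?_ (M.face_isCompact k)
    · let V := IsLinearMap.mk' _ (isLinearMap_val (M := M) (p := p) (M.plus k) x)
      let G := IsLinearMap.mk' _ (isLinearMap_grad (M := M) (p := p) (M.plus k) x)
      let L := uD x • (D.ε • ((η / M.faceSize k) • V - innerₗ (Pt d) (M.normal k) ∘ₗ G)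
        - min (inner ℝ (D.b x) (M.normal k)) 0 • V)
      have h : (fun w : M.DGSpace p => (D.ε * (η / M.faceSize k * val w (M.plus k) x
          - inner ℝ (grad w (M.plus k) x) (M.normal k))
          - min (inner ℝ (D.b x) (M.normal k)) 0 * val w (M.plus k) x) * uD x) = L := by
        ext w
        rw [mul_comm, real_inner_comm (M.normal k)]
        rfl
      rw [h]
      exact L.isLinear
    · exact (continuousOn_const.mul ((continuousOn_const.mul (continuous_val w _).continuousOn).sub
        ((continuous_grad w _).continuousOn.inner continuousOn_const))).sub
        (hbn.mul (continuous_val w _).continuousOn)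
  · exact ⟨fun _ _ => (add_zero _).symm, fun _ _ => (smul_zero _).symm⟩

/-! ### Solvability of the scheme -/

theorem exists_isSolution [Fintype κ] {C : ℝ} (hC : M.IsTraceConstant p C) {η : ℝ}
    (hη : C ^ 2 * M.maxFaces < η) (D : Coefficients M.domain) {γ : M.DGSpace p → ι → ℝ}
    (hγ : ∀ v i, γ v i ≤ 1) (hγc : Continuous γ) {ℓ : M.DGSpace p → ℝ} (hℓ : IsLinearMap ℝ ℓ) :
    ∃ u, M.IsSolution D η γ ℓ u := by
  have hb := isBilinearMap_bilin (p := p) D η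
  refine exists_solution_of_coercive
    (fun u => isLinearMap_add (hb.right u) (isLinearMap_stab D γ u u))
    (fun w => (continuous_of_isLinearMap (hb.left w)).add (continuous_stab D hγc w))
    ((M.isBilinearMap_mass p).const_mul D.σ₀)
    (fun v hv => mul_pos D.σ₀_pos (mass_pos hv)) (fun u => ?_) hℓ
  exact (bilin_ge hC hη D u).trans (le_add_of_nonneg_right (stab_nonneg D hγ u u))

end Forms

end Mesh

end DGWENO

theorem mainTheorem6 {d p : ℕ} (hd : d = 1 ∨ d = 2 ∨ d = 3) (hp : 1 ≤ p)
    {ι κ : Type*} [Fintype ι] [Fintype κ] (M : DGWENO.Mesh d ι κ) :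
    -- the threshold for the penalty parameter exists
    (∃ C : ℝ, M.IsTraceConstant p C) ∧
    -- above the threshold, the scheme is solvable
    ∀ (C : ℝ), M.IsTraceConstant p C → ∀ (η : ℝ), C ^ 2 * M.maxFaces < η →
      ∀ (D : DGWENO.Coefficients M.domain) (γ : M.DGSpace p → ι → ℝ),
        (∀ v i, γ v i ∈ Set.Icc (0 : ℝ) 1) → Continuous γ →
          (∀ ℓ : M.DGSpace p →ₗ[ℝ] ℝ, ∃ u : M.DGSpace p, M.IsSolution D η γ ℓ u) ∧
          (∀ g uD : EuclideanSpace ℝ (Fin d) → ℝ,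
            MeasureTheory.MemLp g 2 (MeasureTheory.volume.restrict M.domain) →
            MeasureTheory.MemLp uD 2
              ((μHE[d - 1] : MeasureTheory.Measure (EuclideanSpace ℝ (Fin d))).restrict
                (frontier M.domain)) →
            ∃ u : M.DGSpace p, M.IsSolution D η γ (M.rhs D η g uD) u) := by
  refine ⟨M.exists_isTraceConstant p, fun C hC η hη D γ hγ hγc => ⟨fun ℓ => ?_,
    fun g uD hg huD => ?_⟩⟩
  · exact DGWENO.Mesh.exists_isSolution hC hη D (fun v i => (hγ v i).2) hγc ℓ.isLinear
  · exact DGWENO.Mesh.exists_isSolution hC hη D (fun v i => (hγ v i).2) hγc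
      (DGWENO.Mesh.isLinearMap_rhs D η hg huD)
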